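/- A rig category is a category $\mathbf{C}$ with two symmetric monoidal structures $(\oplus,0)$ and $(\otimes,I)$ and natural isomorphisms $\delta_{A,B,C}\colon A\otimes(B\oplus C)\to(A\otimes B)\oplus(A\otimes C)$ and $\delta_0\colon A\otimes 0\to 0$ satisfying Laplaza's coherence axioms; it is coaffine when $0$ is initial. A rig functor is a functor equipped with isomorphisms $F(A)\oplus F(B)\simeq F(A\oplus B)$, $0\simeq F(0)$, $F(A)\otimes F(B)\simeq F(A\otimes B)$, $I\simeq F(I)$ making it (strong) symmetric monoidal for $\oplus$ and for $\otimes$ and compatible with $\delta$ and $\delta_0$; rig functors are composed together with these isomorphisms, and are equal when the functors and these isomorphisms are equal. It is strict when these isomorphisms are identities. For a rig category $\mathbf{C}$, let $R(\mathbf{C})$ have the same objects as $\mathbf{C}$; morphisms $A\to B$ are the classes $[f]$ of morphisms $f\colon A\oplus H\to B$ of $\mathbf{C}$, with $H$ any object, under the equivalence relation generated by $f\sim f\circ(\mathrm{id}_A\oplus h)$ for $h\colon H'\to H$. The identity of $A$ is $[\rho^\oplus_A\colon A\oplus 0\to A]$, and for $f\colon A\oplus H\to B$ and $g\colon B\oplus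 K\to C$ the composite $[g]\circ[f]$ is the class of $A\oplus(H\oplus K)\simeq(A\oplus H)\oplus K\xrightarrow{f\oplus\mathrm{id}}B\oplus K\xrightarrow{g}C$. On objects, $\oplus$, $0$, $\otimes$, $I$ are those of $\mathbf{C}$. For $f\colon A\oplus H\to B$ and $f'\colon A'\oplus H'\to B'$, $[f]\oplus[f']$ is the class of $(A\oplus A')\oplus(H\oplus H')\simeq(A\oplus H)\oplus(A'\oplus H')\xrightarrow{f\oplus f'}B\oplus B'$, and $[f]\otimes[f']$ is the class of $(A\otimes A')\oplus\bigl((H\otimes A')\oplus((A\otimes H')\oplus(H\otimes H'))\bigr)\simeq(A\oplus H)\otimes(A'\oplus H')\xrightarrow{f\otimes f'}B\otimes B'$. Let $\mathcal{D}\colon\mathbf{C}\to R(\mathbf{C})$ be the functor that is the identity on objects and sends $f\colon A\to B$ to $[A\oplus 0\xrightarrow{\rho^\oplus}A\xrightarrow{f}B]$; the coherence isomorphisms of $R(\mathbf{C})$ are the images under $\mathcal{D}$ of those of $\mathbf{C}$. Theorem. $R(\mathbf{C})$ is the coaffine completion of the rig category $\mathbf{C}$: $R(\mathbf{C})$ is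 a coaffine rig category, $\mathcal{D}$ is a strict rig functor, and for every coaffine rig category $\mathbf{D}$ and every rig functor $F\colon\mathbf{C}\to\mathbf{D}$ there is a unique rig functor $\hat F\colon R(\mathbf{C})\to\mathbf{D}$ such that $F=\hat F\circ\mathcal{D}$ as rig functors. -/

import Mathlib

open CategoryTheory MonoidalCategory

universe v u v₁ u₁ v₂ u₂

namespace Rig

/-! ## Symmetric monoidal structures

A rig category carries two symmetric monoidal structures on the same category, so these are
structures passed explicitly, split into data and laws.  `toMonoidalCategory` and
`toSymmetricCategory` turn them into Mathlib's classes. -/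

/-- The data of a symmetric monoidal structure on a category. -/
structure SymMonData (C : Type u) [Category.{v} C] where
  obj : C → C → C
  hom : ∀ {A A' B B' : C}, (A ⟶ A') → (B ⟶ B') → (obj A B ⟶ obj A' B')
  one : C
  assoc : ∀ A B D : C, obj (obj A B) D ≅ obj A (obj B D)
  left : ∀ A : C, obj one A ≅ A
  right : ∀ A : C, obj A one ≅ A
  symm : ∀ A B : C, obj A B ≅ obj B A

namespace SymMonData

/-- The laws of a symmetric monoidal category. -/
structure IsSymMon {C : Type u} [Category.{v} C] (S : SymMonData C) : Prop where
  hom_id : ∀ A B : C, S.hom (𝟙 A) (𝟙 B) = 𝟙 (S.obj A B)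
  hom_comp : ∀ {A A' A'' B B' B'' : C} (f : A ⟶ A') (f' : A' ⟶ A'') (g : B ⟶ B') (g' : B' ⟶ B''),
    S.hom (f ≫ f') (g ≫ g') = S.hom f g ≫ S.hom f' g'
  assoc_natural : ∀ {A A' B B' D D' : C} (f : A ⟶ A') (g : B ⟶ B') (h : D ⟶ D'),
    S.hom (S.hom f g) h ≫ (S.assoc A' B' D').hom = (S.assoc A B D).hom ≫ S.hom f (S.hom g h)
  left_natural : ∀ {A A' : C} (f : A ⟶ A'),
    S.hom (𝟙 S.one) f ≫ (S.left A').hom = (S.left A).hom ≫ f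
  right_natural : ∀ {A A' : C} (f : A ⟶ A'),
    S.hom f (𝟙 S.one) ≫ (S.right A').hom = (S.right A).hom ≫ f
  symm_natural : ∀ {A A' B B' : C} (f : A ⟶ A') (g : B ⟶ B'),
    S.hom f g ≫ (S.symm A' B').hom = (S.symm A B).hom ≫ S.hom g f
  pentagon : ∀ A B D E : C,
    S.hom (S.assoc A B D).hom (𝟙 E) ≫ (S.assoc A (S.obj B D) E).hom ≫
        S.hom (𝟙 A) (S.assoc B D E).hom =
      (S.assoc (S.obj A B) D E).hom ≫ (S.assoc A B (S.obj D E)).hom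
  triangle : ∀ A B : C,
    (S.assoc A S.one B).hom ≫ S.hom (𝟙 A) (S.left B).hom = S.hom (S.right A).hom (𝟙 B)
  hexagon : ∀ A B D : C,
    (S.assoc A B D).hom ≫ (S.symm A (S.obj B D)).hom ≫ (S.assoc B D A).hom =
      S.hom (S.symm A B).hom (𝟙 D) ≫ (S.assoc B A D).hom ≫ S.hom (𝟙 B) (S.symm A D).hom
  symmetry : ∀ A B : C, (S.symm A B).hom ≫ (S.symm B A).hom = 𝟙 (S.obj A B)

/-- The middle-four interchange `(A ⬝ B) ⬝ (D ⬝ E) ⟶ (A ⬝ D) ⬝ (B ⬝ E)`. -/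
def mid {C : Type u} [Category.{v} C] (S : SymMonData C) (A B D E : C) :
    S.obj (S.obj A B) (S.obj D E) ⟶ S.obj (S.obj A D) (S.obj B E) :=
  (S.assoc A B (S.obj D E)).hom ≫ S.hom (𝟙 A) (S.assoc B D E).inv ≫
    S.hom (𝟙 A) (S.hom (S.symm B D).hom (𝟙 E)) ≫ S.hom (𝟙 A) (S.assoc D B E).hom ≫
    (S.assoc A D (S.obj B E)).inv

/-- The corresponding Mathlib data. -/
abbrev toStruct {C : Type u} [Category.{v} C] (S : SymMonData C) : MonoidalCategoryStruct C where
  tensorObj := S.obj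
  whiskerLeft X _ _ f := S.hom (𝟙 X) f
  whiskerRight f Y := S.hom f (𝟙 Y)
  tensorHom f g := S.hom f g
  tensorUnit := S.one
  associator := S.assoc
  leftUnitor := S.left
  rightUnitor := S.right

/-- The corresponding Mathlib monoidal category. -/
abbrev IsSymMon.toMonoidalCategory {C : Type u} [Category.{v} C] {S : SymMonData C}
    (h : S.IsSymMon) : MonoidalCategory C :=
  letI := S.toStruct
  MonoidalCategory.ofTensorHom (C := C)
    (id_tensorHom_id := h.hom_id)
    (id_tensorHom := fun _ _ _ _ => rfl)
    (tensorHom_id := fun _ _ => rfl)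
    (tensorHom_comp_tensorHom := fun f g f' g' => (h.hom_comp f f' g g').symm)
    (associator_naturality := h.assoc_natural)
    (leftUnitor_naturality := h.left_natural)
    (rightUnitor_naturality := h.right_natural)
    (pentagon := h.pentagon)
    (triangle := h.triangle)

/-- The corresponding Mathlib symmetric monoidal category. -/
abbrev IsSymMon.toSymmetricCategory {C : Type u} [Category.{v} C] {S : SymMonData C}
    (h : S.IsSymMon) : @SymmetricCategory C _ h.toMonoidalCategory :=
  letI := h.toMonoidalCategory
  { braiding := S.symm
    braiding_naturality_right := fun X _ _ f => h.symm_natural (𝟙 X) f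
    braiding_naturality_left := fun f Z => h.symm_natural f (𝟙 Z)
    hexagon_forward := h.hexagon
    hexagon_reverse := fun X Y Z => by
      have e₁ : S.hom (𝟙 X) (S.symm Y Z).hom ≫ S.hom (𝟙 X) (S.symm Z Y).hom = 𝟙 _ := by
        rw [← h.hom_comp, h.symmetry, Category.comp_id, h.hom_id]
      have e₂ : S.hom (S.symm X Z).hom (𝟙 Y) ≫ S.hom (S.symm Z X).hom (𝟙 Y) = 𝟙 _ := by
        rw [← h.hom_comp, h.symmetry, Category.comp_id, h.hom_id]
      have e₃ := h.hexagon Z X Y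
      have e₄ := h.symmetry (S.obj X Y) Z
      change (S.assoc X Y Z).inv ≫ (S.symm (S.obj X Y) Z).hom ≫ (S.assoc Z X Y).inv =
        S.hom (𝟙 X) (S.symm Y Z).hom ≫ (S.assoc X Z Y).inv ≫ S.hom (S.symm X Z).hom (𝟙 Y)
      have : IsIso ((S.assoc Z X Y).hom ≫ (S.symm Z (S.obj X Y)).hom ≫ (S.assoc X Y Z).hom) :=
        ⟨(S.assoc X Y Z).inv ≫ (S.symm (S.obj X Y) Z).hom ≫ (S.assoc Z X Y).inv, by
          simp [reassoc_of% (h.symmetry Z (S.obj X Y))], by simp [reassoc_of% e₄]⟩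
      rw [← cancel_mono ((S.assoc Z X Y).hom ≫ (S.symm Z (S.obj X Y)).hom ≫ (S.assoc X Y Z).hom)]
      conv_rhs => rw [e₃]
      simp [reassoc_of% e₄, reassoc_of% e₂, e₁]
    symmetry := h.symmetry }

namespace IsSymMon

theorem assoc_inv_natural {C : Type u} [Category.{v} C] {S : SymMonData C} (h : S.IsSymMon)
    {A A' B B' D D' : C} (f : A ⟶ A') (g : B ⟶ B') (k : D ⟶ D') :
    S.hom f (S.hom g k) ≫ (S.assoc A' B' D').inv =
      (S.assoc A B D).inv ≫ S.hom (S.hom f g) k := by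
  rw [Iso.comp_inv_eq, Category.assoc, h.assoc_natural, Iso.inv_hom_id_assoc]

theorem mid_natural {C : Type u} [Category.{v} C] {S : SymMonData C} (h : S.IsSymMon)
    {A A' B B' D D' E E' : C} (f : A ⟶ A') (g : B ⟶ B') (k : D ⟶ D') (l : E ⟶ E') :
    S.hom (S.hom f g) (S.hom k l) ≫ S.mid A' B' D' E' =
      S.mid A B D E ≫ S.hom (S.hom f k) (S.hom g l) := by
  let _ := h.toMonoidalCategory
  let _ := h.toSymmetricCategory
  exact MonoidalCategory.tensorμ_natural f g k l

/-! Facts for sequential composition with a heap. -/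

theorem comp_mediated_right {C : Type u} [Category.{v} C] {S : SymMonData C} (h : S.IsSymMon)
    {A B D H K K' : C} (f : S.obj A H ⟶ B) (g : S.obj B K ⟶ D) (k : K' ⟶ K) :
    (S.assoc A H K').inv ≫ S.hom f (𝟙 K') ≫ S.hom (𝟙 B) k ≫ g =
      S.hom (𝟙 A) (S.hom (𝟙 H) k) ≫ (S.assoc A H K).inv ≫ S.hom f (𝟙 K) ≫ g := by
  rw [reassoc_of% h.assoc_inv_natural, ← reassoc_of% h.hom_comp, ← reassoc_of% h.hom_comp]
  simp [h.hom_id]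

theorem comp_mediated_left {C : Type u} [Category.{v} C] {S : SymMonData C} (h : S.IsSymMon)
    {A B D H H' K : C} (f : S.obj A H ⟶ B) (g : S.obj B K ⟶ D) (k : H' ⟶ H) :
    (S.assoc A H' K).inv ≫ S.hom (S.hom (𝟙 A) k ≫ f) (𝟙 K) ≫ g =
      S.hom (𝟙 A) (S.hom k (𝟙 K)) ≫ (S.assoc A H K).inv ≫ S.hom f (𝟙 K) ≫ g := by
  rw [reassoc_of% h.assoc_inv_natural, ← reassoc_of% h.hom_comp]
  simp

theorem comp_right_unitor {C : Type u} [Category.{v} C] {S : SymMonData C} (h : S.IsSymMon)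
    {A A' D K : C} (f : A ⟶ A') (g : S.obj A' K ⟶ D) :
    S.hom f (𝟙 K) ≫ g =
      S.hom (𝟙 A) (S.left K).inv ≫ (S.assoc A S.one K).inv ≫
        S.hom ((S.right A).hom ≫ f) (𝟙 K) ≫ g := by
  have e : S.hom ((S.right A).hom ≫ f) (𝟙 K) =
      (S.assoc A S.one K).hom ≫ S.hom (𝟙 A) (S.left K).hom ≫ S.hom f (𝟙 K) := by
    rw [reassoc_of% h.triangle, ← h.hom_comp, Category.comp_id]
  rw [e]
  simp only [Category.assoc, Iso.inv_hom_id_assoc]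
  rw [← reassoc_of% h.hom_comp]
  simp [h.hom_id]

theorem comp_right_unitor' {C : Type u} [Category.{v} C] {S : SymMonData C} (h : S.IsSymMon)
    {A B B' H : C} (f : S.obj A H ⟶ B) (g : B ⟶ B') :
    f ≫ g = S.hom (𝟙 A) (S.right H).inv ≫ (S.assoc A H S.one).inv ≫
      S.hom f (𝟙 S.one) ≫ (S.right B).hom ≫ g := by
  rw [reassoc_of% h.right_natural]
  let _ := h.toMonoidalCategory
  have e : S.hom (𝟙 A) (S.right H).inv ≫ (S.assoc A H S.one).inv ≫ (S.right (S.obj A H)).hom =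
      𝟙 (S.obj A H) := by
    have : A ◁ (ρ_ H).inv ≫ (α_ A H (𝟙_ C)).inv ≫ (ρ_ (A ⊗ H)).hom = 𝟙 (A ⊗ H) := by simp
    exact this
  rw [reassoc_of% e]

theorem comp_assoc {C : Type u} [Category.{v} C] {S : SymMonData C} (h : S.IsSymMon)
    {A B D E H K L : C} (f : S.obj A H ⟶ B) (g : S.obj B K ⟶ D) (k : S.obj D L ⟶ E) :
    (S.assoc A (S.obj H K) L).inv ≫
        S.hom ((S.assoc A H K).inv ≫ S.hom f (𝟙 K) ≫ g) (𝟙 L) ≫ k =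
      S.hom (𝟙 A) (S.assoc H K L).hom ≫ (S.assoc A H (S.obj K L)).inv ≫
        S.hom f (𝟙 (S.obj K L)) ≫ (S.assoc B K L).inv ≫ S.hom g (𝟙 L) ≫ k := by
  let _ := h.toMonoidalCategory
  have : ∀ (f : A ⊗ H ⟶ B) (g : B ⊗ K ⟶ D) (k : D ⊗ L ⟶ E),
      (α_ A (H ⊗ K) L).inv ≫ ((α_ A H K).inv ≫ f ▷ K ≫ g) ▷ L ≫ k =
        A ◁ (α_ H K L).hom ≫ (α_ A H (K ⊗ L)).inv ≫ f ▷ (K ⊗ L) ≫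
          (α_ B K L).inv ≫ g ▷ L ≫ k := by
    intro f g k
    simp
  exact this f g k

end IsSymMon

end SymMonData

/-! ## Rig categories -/

/-- The data of a rig category: two symmetric monoidal structures `(⊞, 0)` (`add`) and `(⊠, I)`
(`mul`), distributors `A ⊠ (B ⊞ D) ≅ (A ⊠ B) ⊞ (A ⊠ D)` and annihilators `A ⊠ 0 ≅ 0`. -/
class RigData (C : Type u) [Category.{v} C] where
  add : SymMonData C
  mul : SymMonData C
  distrib : ∀ A B D : C,
    mul.obj A (add.obj B D) ≅ add.obj (mul.obj A B) (mul.obj A D)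
  annih : ∀ A : C, mul.obj A add.one ≅ add.one

open RigData

local infixr:65 " ⊞ " => SymMonData.obj add
local infixr:70 " ⊠ " => SymMonData.obj mul
local infixr:65 " ⊞ₕ " => SymMonData.hom add
local infixr:70 " ⊠ₕ " => SymMonData.hom mul

/-- The zero object (unit of `⊞`). -/
abbrev zero (C : Type u) [Category.{v} C] [RigData C] : C := (add (C := C)).one

/-- The unit object (unit of `⊠`). -/
abbrev unit (C : Type u) [Category.{v} C] [RigData C] : C := (mul (C := C)).one

/-- The right distributor, obtained from the left one by the symmetry of `⊠`. -/
def rdistrib {C : Type u} [Category.{v} C] [RigData C] (A B D : C) :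
    (A ⊞ B) ⊠ D ⟶ (A ⊠ D) ⊞ (B ⊠ D) :=
  (mul.symm (A ⊞ B) D).hom ≫ (distrib D A B).hom ≫
    ((mul.symm D A).hom ⊞ₕ (mul.symm D B).hom)

/-- The inverse of the right distributor. -/
def rdistribInv {C : Type u} [Category.{v} C] [RigData C] (A B D : C) :
    (A ⊠ D) ⊞ (B ⊠ D) ⟶ (A ⊞ B) ⊠ D :=
  ((mul.symm D A).inv ⊞ₕ (mul.symm D B).inv) ≫ (distrib D A B).inv ≫
    (mul.symm (A ⊞ B) D).inv

/-- The left annihilator `0 ⊠ A ⟶ 0`, obtained from the right one by the symmetry of `⊠`. -/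
def lannih {C : Type u} [Category.{v} C] [RigData C] (A : C) :
    zero C ⊠ A ⟶ zero C :=
  (mul.symm (zero C) A).hom ≫ (annih A).hom

/-- The laws of a rig category: both structures are symmetric monoidal, the distributors and
annihilators are natural, and Laplaza's coherence axioms hold. (The two axioms that express the
right distributor and the left annihilator through the symmetry of `⊠` hold by definition.) -/
class IsRigCategory (C : Type u) [Category.{v} C] [RigData C] : Prop where
  isAdd : (RigData.add : SymMonData C).IsSymMon
  isMul : (RigData.mul : SymMonData C).IsSymMon
  distrib_natural : ∀ {A A' B B' D D' : C} (f : A ⟶ A') (g : B ⟶ B') (h : D ⟶ D'),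
    (f ⊠ₕ (g ⊞ₕ h)) ≫ (distrib A' B' D').hom =
      (distrib A B D).hom ≫ ((f ⊠ₕ g) ⊞ₕ (f ⊠ₕ h))
  annih_natural : ∀ {A A' : C} (f : A ⟶ A'),
    (f ⊠ₕ 𝟙 (zero C)) ≫ (annih A').hom = (annih A).hom
  -- distributors and the symmetry of `⊞`
  distrib_symm : ∀ A B D : C,
    (distrib A B D).hom ≫ (add.symm (A ⊠ B) (A ⊠ D)).hom =
      (𝟙 A ⊠ₕ (add.symm B D).hom) ≫ (distrib A D B).hom
  rdistrib_symm : ∀ A B D : C,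
    rdistrib A B D ≫ (add.symm (A ⊠ D) (B ⊠ D)).hom =
      ((add.symm A B).hom ⊠ₕ 𝟙 D) ≫ rdistrib B A D
  -- distributors and the associator of `⊞`
  distrib_add_assoc : ∀ A B D E : C,
    (distrib A (B ⊞ D) E).hom ≫ ((distrib A B D).hom ⊞ₕ 𝟙 (A ⊠ E)) ≫
        (add.assoc (A ⊠ B) (A ⊠ D) (A ⊠ E)).hom =
      (𝟙 A ⊠ₕ (add.assoc B D E).hom) ≫ (distrib A B (D ⊞ E)).hom ≫
        (𝟙 (A ⊠ B) ⊞ₕ (distrib A D E).hom)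
  rdistrib_add_assoc : ∀ A B D E : C,
    rdistrib (A ⊞ B) D E ≫ (rdistrib A B E ⊞ₕ 𝟙 (D ⊠ E)) ≫
        (add.assoc (A ⊠ E) (B ⊠ E) (D ⊠ E)).hom =
      ((add.assoc A B D).hom ⊠ₕ 𝟙 E) ≫ rdistrib A (B ⊞ D) E ≫
        (𝟙 (A ⊠ E) ⊞ₕ rdistrib B D E)
  -- distributors and the associator of `⊠`
  distrib_mul_assoc : ∀ A B D E : C,
    (mul.assoc A B (D ⊞ E)).hom ≫ (𝟙 A ⊠ₕ (distrib B D E).hom) ≫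
        (distrib A (B ⊠ D) (B ⊠ E)).hom =
      (distrib (A ⊠ B) D E).hom ≫ ((mul.assoc A B D).hom ⊞ₕ (mul.assoc A B E).hom)
  rdistrib_mul_assoc : ∀ A B D E : C,
    (rdistrib A B D ⊠ₕ 𝟙 E) ≫ rdistrib (A ⊠ D) (B ⊠ D) E ≫
        ((mul.assoc A D E).hom ⊞ₕ (mul.assoc B D E).hom) =
      (mul.assoc (A ⊞ B) D E).hom ≫ rdistrib A B (D ⊠ E)
  distrib_rdistrib_mul_assoc : ∀ A B D E : C,
    (mul.assoc A (B ⊞ D) E).hom ≫ (𝟙 A ⊠ₕ rdistrib B D E) ≫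
        (distrib A (B ⊠ E) (D ⊠ E)).hom =
      ((distrib A B D).hom ⊠ₕ 𝟙 E) ≫ rdistrib (A ⊠ B) (A ⊠ D) E ≫
        ((mul.assoc A B E).hom ⊞ₕ (mul.assoc A D E).hom)
  -- the two ways of expanding a product of two sums
  distrib_rdistrib : ∀ A B D E : C,
    (distrib (A ⊞ B) D E).hom ≫ (rdistrib A B D ⊞ₕ rdistrib A B E) =
      rdistrib A B (D ⊞ E) ≫ ((distrib A D E).hom ⊞ₕ (distrib B D E).hom) ≫
        add.mid (A ⊠ D) (A ⊠ E) (B ⊠ D) (B ⊠ E)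
  -- annihilators
  lannih_zero : lannih (zero C) = (annih (zero C)).hom
  lannih_add : ∀ A B : C,
    lannih (A ⊞ B) =
      (distrib (zero C) A B).hom ≫ (lannih A ⊞ₕ lannih B) ≫ (add.left (zero C)).hom
  annih_add : ∀ A B : C,
    (annih (A ⊞ B)).hom =
      rdistrib A B (zero C) ≫ ((annih A).hom ⊞ₕ (annih B).hom) ≫ (add.left (zero C)).hom
  lannih_unit : lannih (unit C) = (mul.right (zero C)).hom
  annih_unit : (annih (unit C)).hom = (mul.left (zero C)).hom
  lannih_mul : ∀ A B : C,
    (mul.assoc (zero C) A B).hom ≫ lannih (A ⊠ B) = (lannih A ⊠ₕ 𝟙 B) ≫ lannih B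
  lannih_annih_mul : ∀ A B : C,
    (mul.assoc A (zero C) B).hom ≫ (𝟙 A ⊠ₕ lannih B) ≫ (annih A).hom =
      ((annih A).hom ⊠ₕ 𝟙 B) ≫ lannih B
  annih_mul : ∀ A B : C,
    (mul.assoc A B (zero C)).hom ≫ (𝟙 A ⊠ₕ (annih B).hom) ≫ (annih A).hom =
      (annih (A ⊠ B)).hom
  -- distributors and the unitors
  distrib_add_left : ∀ A B : C,
    (distrib A (zero C) B).hom ≫ ((annih A).hom ⊞ₕ 𝟙 (A ⊠ B)) ≫ (add.left (A ⊠ B)).hom =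
      𝟙 A ⊠ₕ (add.left B).hom
  rdistrib_add_left : ∀ A B : C,
    rdistrib (zero C) B A ≫ (lannih A ⊞ₕ 𝟙 (B ⊠ A)) ≫ (add.left (B ⊠ A)).hom =
      (add.left B).hom ⊠ₕ 𝟙 A
  distrib_add_right : ∀ A B : C,
    (distrib A B (zero C)).hom ≫ (𝟙 (A ⊠ B) ⊞ₕ (annih A).hom) ≫ (add.right (A ⊠ B)).hom =
      𝟙 A ⊠ₕ (add.right B).hom
  rdistrib_add_right : ∀ A B : C,
    rdistrib A (zero C) B ≫ (𝟙 (A ⊠ B) ⊞ₕ lannih B) ≫ (add.right (A ⊠ B)).hom =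
      (add.right A).hom ⊠ₕ 𝟙 B
  distrib_mul_left : ∀ A B : C,
    (distrib (unit C) A B).hom ≫ ((mul.left A).hom ⊞ₕ (mul.left B).hom) =
      (mul.left (A ⊞ B)).hom
  rdistrib_mul_right : ∀ A B : C,
    rdistrib A B (unit C) ≫ ((mul.right A).hom ⊞ₕ (mul.right B).hom) =
      (mul.right (A ⊞ B)).hom

/-- A rig category is coaffine when its zero object is initial. -/
def IsCoaffine (C : Type u) [Category.{v} C] [RigData C] : Prop :=
  ∀ A : C, Nonempty (Unique (zero C ⟶ A))

/-! ## Rig functors -/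

/-- Isomorphisms `F A ⬝ F B ≅ F (A ⬝ B)` and `1 ≅ F 1` for a map `F` on objects. -/
@[ext]
structure TensorComparison {C : Type u₁} [Category.{v₁} C] {E : Type u₂} [Category.{v₂} E]
    (S : SymMonData C) (T : SymMonData E) (F : C → E) where
  μ : ∀ A B : C, T.obj (F A) (F B) ≅ F (S.obj A B)
  ε : T.one ≅ F S.one

/-- The laws of a (strong) symmetric monoidal functor. -/
structure TensorComparison.IsMonoidal {C : Type u₁} [Category.{v₁} C] {E : Type u₂}
    [Category.{v₂} E] {S : SymMonData C} {T : SymMonData E} (F : C ⥤ E)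
    (c : TensorComparison S T F.obj) : Prop where
  natural : ∀ {A A' B B' : C} (f : A ⟶ A') (g : B ⟶ B'),
    T.hom (F.map f) (F.map g) ≫ (c.μ A' B').hom = (c.μ A B).hom ≫ F.map (S.hom f g)
  assoc : ∀ A B D : C,
    T.hom (c.μ A B).hom (𝟙 (F.obj D)) ≫ (c.μ (S.obj A B) D).hom ≫ F.map (S.assoc A B D).hom =
      (T.assoc (F.obj A) (F.obj B) (F.obj D)).hom ≫ T.hom (𝟙 (F.obj A)) (c.μ B D).hom ≫
        (c.μ A (S.obj B D)).hom
  left : ∀ A : C,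
    (T.left (F.obj A)).hom =
      T.hom c.ε.hom (𝟙 (F.obj A)) ≫ (c.μ S.one A).hom ≫ F.map (S.left A).hom
  right : ∀ A : C,
    (T.right (F.obj A)).hom =
      T.hom (𝟙 (F.obj A)) c.ε.hom ≫ (c.μ A S.one).hom ≫ F.map (S.right A).hom
  symm : ∀ A B : C,
    (c.μ A B).hom ≫ F.map (S.symm A B).hom =
      (T.symm (F.obj A) (F.obj B)).hom ≫ (c.μ B A).hom

/-- The data of a rig functor: a functor with comparison isomorphisms for `⊞` and `⊠`. -/
structure RigFunctorData (C : Type u₁) [Category.{v₁} C] [RigData C]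
    (E : Type u₂) [Category.{v₂} E] [RigData E] extends C ⥤ E where
  addComp : TensorComparison (add : SymMonData C) (add : SymMonData E) obj
  mulComp : TensorComparison (mul : SymMonData C) (mul : SymMonData E) obj

/-- The laws of a rig functor: it is symmetric monoidal for `⊞` and for `⊠`, and it respects the
distributors and annihilators. -/
structure RigFunctorData.IsRigFunctor {C : Type u₁} [Category.{v₁} C] [RigData C]
    {E : Type u₂} [Category.{v₂} E] [RigData E] (F : RigFunctorData C E) : Prop where
  isAdd : F.addComp.IsMonoidal F.toFunctor
  isMul : F.mulComp.IsMonoidal F.toFunctor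
  distrib : ∀ A B D : C,
    (𝟙 (F.obj A) ⊠ₕ (F.addComp.μ B D).hom) ≫ (F.mulComp.μ A (B ⊞ D)).hom ≫
        F.map (distrib A B D).hom =
      (RigData.distrib (F.obj A) (F.obj B) (F.obj D)).hom ≫
        ((F.mulComp.μ A B).hom ⊞ₕ (F.mulComp.μ A D).hom) ≫ (F.addComp.μ (A ⊠ B) (A ⊠ D)).hom
  annih : ∀ A : C,
    (𝟙 (F.obj A) ⊠ₕ F.addComp.ε.hom) ≫ (F.mulComp.μ A (zero C)).hom ≫ F.map (annih A).hom =
      (RigData.annih (F.obj A)).hom ≫ F.addComp.ε.hom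

/-- The composite of rig functors, on the level of data. -/
def RigFunctorData.comp {C : Type u} [Category.{v} C] [RigData C]
    {E : Type u₁} [Category.{v₁} E] [RigData E] {K : Type u₂} [Category.{v₂} K] [RigData K]
    (F : RigFunctorData C E) (G : RigFunctorData E K) : RigFunctorData C K where
  toFunctor := F.toFunctor ⋙ G.toFunctor
  addComp :=
    { μ := fun A B => G.addComp.μ (F.obj A) (F.obj B) ≪≫ G.mapIso (F.addComp.μ A B)
      ε := G.addComp.ε ≪≫ G.mapIso F.addComp.ε }
  mulComp :=
    { μ := fun A B => G.mulComp.μ (F.obj A) (F.obj B) ≪≫ G.mapIso (F.mulComp.μ A B)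
      ε := G.mulComp.ε ≪≫ G.mapIso F.mulComp.ε }

/-! ## The completion -/

/-- The objects of the completion are those of `C`. -/
structure Completion (C : Type u) where
  of : C

namespace Completion

variable {C : Type u} [Category.{v} C] [RigData C]

/-- A program with a heap: a morphism `A ⊞ heap ⟶ B` of `C`. -/
structure HeapHom (A B : C) where
  heap : C
  map : A ⊞ heap ⟶ B

/-- `g` arises from `f` by preprocessing the heap with a mediator `h`. -/
def Mediated {A B : C} (f g : HeapHom A B) : Prop :=
  ∃ h : g.heap ⟶ f.heap, g.map = (𝟙 A ⊞ₕ h) ≫ f.map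

/-- Morphisms of the completion: programs with a heap modulo the equivalence relation generated
by `Mediated`. -/
def Hom (A B : C) : Type (max u v) := Quot (Mediated (A := A) (B := B))

/-- The class of `f : A ⊞ H ⟶ B`. -/
def Hom.mk {A B H : C} (f : A ⊞ H ⟶ B) : Hom A B := Quot.mk _ ⟨H, f⟩

theorem Hom.mk_eq {A B H H' : C} (f : A ⊞ H ⟶ B) (f' : A ⊞ H' ⟶ B) (h : H' ⟶ H)
    (e : f' = (𝟙 A ⊞ₕ h) ≫ f) : (Hom.mk f : Hom A B) = Hom.mk f' :=
  Quot.sound ⟨h, e⟩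

theorem Hom.ind {A B : C} {P : Hom A B → Prop} (h : ∀ (H : C) (f : A ⊞ H ⟶ B), P (Hom.mk f))
    (f : Hom A B) : P f :=
  Quot.ind (fun f => h f.heap f.map) f

/-- Sequential composition of representatives. -/
def HeapHom.comp {A B D : C} (f : HeapHom A B) (g : HeapHom B D) : HeapHom A D where
  heap := f.heap ⊞ g.heap
  map := (add.assoc A f.heap g.heap).inv ≫ (f.map ⊞ₕ 𝟙 g.heap) ≫ g.map

/-- The sum of representatives. -/
def HeapHom.add {A A' B B' : C} (f : HeapHom A B) (g : HeapHom A' B') :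
    HeapHom (A ⊞ A') (B ⊞ B') where
  heap := f.heap ⊞ g.heap
  map := RigData.add.mid A A' f.heap g.heap ≫ (f.map ⊞ₕ g.map)

/-- The distributivity isomorphism
`(A ⊠ A') ⊞ (H ⊠ A' ⊞ A ⊠ H' ⊞ H ⊠ H') ⟶ (A ⊞ H) ⊠ (A' ⊞ H')`. -/
def expandInv (A H A' H' : C) :
    (A ⊠ A') ⊞ ((H ⊠ A') ⊞ ((A ⊠ H') ⊞ (H ⊠ H'))) ⟶ (A ⊞ H) ⊠ (A' ⊞ H') :=
  (add.assoc (A ⊠ A') (H ⊠ A') ((A ⊠ H') ⊞ (H ⊠ H'))).inv ≫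
    (rdistribInv A H A' ⊞ₕ rdistribInv A H H') ≫ (distrib (A ⊞ H) A' H').inv

/-- The product of representatives. -/
def HeapHom.mul {A A' B B' : C} (f : HeapHom A B) (g : HeapHom A' B') :
    HeapHom (A ⊠ A') (B ⊠ B') where
  heap := (f.heap ⊠ A') ⊞ ((A ⊠ g.heap) ⊞ (f.heap ⊠ g.heap))
  map := expandInv A f.heap A' g.heap ≫ (f.map ⊠ₕ g.map)

variable [IsRigCategory C]

theorem rdistrib_rdistribInv (A B D : C) : rdistrib A B D ≫ rdistribInv A B D = 𝟙 _ := by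
  have h := IsRigCategory.isAdd (C := C)
  simp [rdistrib, rdistribInv, ← reassoc_of% h.hom_comp, h.hom_id]

theorem rdistribInv_rdistrib (A B D : C) : rdistribInv A B D ≫ rdistrib A B D = 𝟙 _ := by
  have h := IsRigCategory.isAdd (C := C)
  simp [rdistrib, rdistribInv, ← h.hom_comp, h.hom_id]

theorem rdistrib_natural {A A' B B' D D' : C} (f : A ⟶ A') (g : B ⟶ B') (k : D ⟶ D') :
    ((f ⊞ₕ g) ⊠ₕ k) ≫ rdistrib A' B' D' = rdistrib A B D ≫ ((f ⊠ₕ k) ⊞ₕ (g ⊠ₕ k)) := by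
  have h := IsRigCategory.isAdd (C := C)
  have h' := IsRigCategory.isMul (C := C)
  simp only [rdistrib, Category.assoc]
  rw [reassoc_of% h'.symm_natural, reassoc_of% IsRigCategory.distrib_natural, ← h.hom_comp,
    ← h.hom_comp, h'.symm_natural, h'.symm_natural]

theorem rdistribInv_natural {A A' B B' D D' : C} (f : A ⟶ A') (g : B ⟶ B') (k : D ⟶ D') :
    ((f ⊠ₕ k) ⊞ₕ (g ⊠ₕ k)) ≫ rdistribInv A' B' D' = rdistribInv A B D ≫ ((f ⊞ₕ g) ⊠ₕ k) := by
  have e := rdistribInv A B D ≫= rdistrib_natural f g k =≫ rdistribInv A' B' D'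
  simpa [rdistrib_rdistribInv, reassoc_of% rdistribInv_rdistrib] using e.symm

theorem distribInv_natural {A A' B B' D D' : C} (f : A ⟶ A') (g : B ⟶ B') (k : D ⟶ D') :
    ((f ⊠ₕ g) ⊞ₕ (f ⊠ₕ k)) ≫ (distrib A' B' D').inv =
      (distrib A B D).inv ≫ (f ⊠ₕ (g ⊞ₕ k)) := by
  rw [Iso.comp_inv_eq, Category.assoc, IsRigCategory.distrib_natural, Iso.inv_hom_id_assoc]

theorem expandInv_natural {A A₁ H H₁ A' A₁' H' H₁' : C} (f : A ⟶ A₁) (h : H ⟶ H₁)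
    (f' : A' ⟶ A₁') (h' : H' ⟶ H₁') :
    ((f ⊠ₕ f') ⊞ₕ ((h ⊠ₕ f') ⊞ₕ ((f ⊠ₕ h') ⊞ₕ (h ⊠ₕ h')))) ≫ expandInv A₁ H₁ A₁' H₁' =
      expandInv A H A' H' ≫ ((f ⊞ₕ h) ⊠ₕ (f' ⊞ₕ h')) := by
  have ha := IsRigCategory.isAdd (C := C)
  simp only [expandInv, Category.assoc]
  rw [reassoc_of% ha.assoc_inv_natural, ← reassoc_of% ha.hom_comp, rdistribInv_natural,
    rdistribInv_natural, ha.hom_comp, Category.assoc, distribInv_natural]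

theorem mulMap_mediated {A A' B B' H H₁ H' H₁' : C} (f : A ⊞ H₁ ⟶ B) (f' : A' ⊞ H₁' ⟶ B')
    (h : H ⟶ H₁) (h' : H' ⟶ H₁') :
    expandInv A H A' H' ≫ (((𝟙 A ⊞ₕ h) ≫ f) ⊠ₕ ((𝟙 A' ⊞ₕ h') ≫ f')) =
      (𝟙 (A ⊠ A') ⊞ₕ ((h ⊠ₕ 𝟙 A') ⊞ₕ ((𝟙 A ⊠ₕ h') ⊞ₕ (h ⊠ₕ h')))) ≫
        expandInv A H₁ A' H₁' ≫ (f ⊠ₕ f') := by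
  have hm := IsRigCategory.isMul (C := C)
  rw [hm.hom_comp, ← reassoc_of% expandInv_natural, hm.hom_id]

theorem addMap_mediated {A A' B B' H H₁ H' H₁' : C} (f : A ⊞ H₁ ⟶ B) (f' : A' ⊞ H₁' ⟶ B')
    (h : H ⟶ H₁) (h' : H' ⟶ H₁') :
    RigData.add.mid A A' H H' ≫ (((𝟙 A ⊞ₕ h) ≫ f) ⊞ₕ ((𝟙 A' ⊞ₕ h') ≫ f')) =
      (𝟙 (A ⊞ A') ⊞ₕ (h ⊞ₕ h')) ≫ RigData.add.mid A A' H₁ H₁' ≫ (f ⊞ₕ f') := by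
  have ha := IsRigCategory.isAdd (C := C)
  rw [ha.hom_comp, ← reassoc_of% ha.mid_natural, ha.hom_id]

/-- Composition in the completion. -/
def Hom.comp {A B D : C} : Hom A B → Hom B D → Hom A D :=
  Quot.map₂ HeapHom.comp
    (by
      rintro ⟨H, f⟩ ⟨K, g⟩ ⟨K', g'⟩ ⟨k, e⟩
      dsimp only at k e
      exact ⟨𝟙 H ⊞ₕ k, by
        subst e; exact IsRigCategory.isAdd.comp_mediated_right f g k⟩)
    (by
      rintro ⟨H, f⟩ ⟨H', f'⟩ ⟨K, g⟩ ⟨h, e⟩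
      dsimp only at h e
      exact ⟨h ⊞ₕ 𝟙 K, by
        subst e; exact IsRigCategory.isAdd.comp_mediated_left f g h⟩)

/-- The sum of morphisms of the completion. -/
def Hom.add {A A' B B' : C} : Hom A B → Hom A' B' → Hom (A ⊞ A') (B ⊞ B') :=
  Quot.map₂ HeapHom.add
    (by
      rintro ⟨H, f⟩ ⟨K, g⟩ ⟨K', g'⟩ ⟨k, e⟩
      dsimp only at k e
      have ha := IsRigCategory.isAdd (C := C)
      exact ⟨𝟙 H ⊞ₕ k, by
        subst e; simpa [HeapHom.add, ha.hom_id] using addMap_mediated f g (𝟙 H) k⟩)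
    (by
      rintro ⟨H, f⟩ ⟨H', f'⟩ ⟨K, g⟩ ⟨h, e⟩
      dsimp only at h e
      have ha := IsRigCategory.isAdd (C := C)
      exact ⟨h ⊞ₕ 𝟙 K, by
        subst e; simpa [HeapHom.add, ha.hom_id] using addMap_mediated f g h (𝟙 K)⟩)

/-- The product of morphisms of the completion. -/
def Hom.mul {A A' B B' : C} : Hom A B → Hom A' B' → Hom (A ⊠ A') (B ⊠ B') :=
  Quot.map₂ HeapHom.mul
    (by
      rintro ⟨H, f⟩ ⟨K, g⟩ ⟨K', g'⟩ ⟨k, e⟩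
      dsimp only at k e
      have ha := IsRigCategory.isAdd (C := C)
      exact ⟨(𝟙 H ⊠ₕ 𝟙 _) ⊞ₕ ((𝟙 _ ⊠ₕ k) ⊞ₕ (𝟙 H ⊠ₕ k)), by
        subst e; simpa [HeapHom.mul, ha.hom_id] using mulMap_mediated f g (𝟙 H) k⟩)
    (by
      rintro ⟨H, f⟩ ⟨H', f'⟩ ⟨K, g⟩ ⟨h, e⟩
      dsimp only at h e
      have ha := IsRigCategory.isAdd (C := C)
      exact ⟨(h ⊠ₕ 𝟙 _) ⊞ₕ ((𝟙 _ ⊠ₕ 𝟙 K) ⊞ₕ (h ⊠ₕ 𝟙 K)), by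
        subst e; simpa [HeapHom.mul, ha.hom_id] using mulMap_mediated f g h (𝟙 K)⟩)

instance : Category.{max u v} (Completion C) where
  Hom A B := Hom A.of B.of
  id A := Hom.mk (RigData.add.right A.of).hom
  comp f g := f.comp g
  id_comp f := by
    induction f using Hom.ind with | h K f => ?_
    refine Hom.mk_eq _ _ (RigData.add.left K).inv ?_
    have ha := IsRigCategory.isAdd (C := C)
    simpa [ha.hom_id] using ha.comp_right_unitor (𝟙 _) f
  comp_id f := by
    induction f using Hom.ind with | h H f => ?_
    refine Hom.mk_eq _ _ (RigData.add.right H).inv ?_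
    simpa using IsRigCategory.isAdd.comp_right_unitor' f (𝟙 _)
  assoc f g k := by
    induction f using Hom.ind with | h H f => ?_
    induction g using Hom.ind with | h K g => ?_
    induction k using Hom.ind with | h L k => ?_
    exact (Hom.mk_eq _ _ (RigData.add.assoc H K L).hom
      (IsRigCategory.isAdd.comp_assoc f g k)).symm

/-- The functor from `C` to its completion: the identity on objects, and a morphism `f` goes to
the class of `A ⊞ 0 ⟶ A ⟶ B`. -/
def inclFunctor (C : Type u) [Category.{v} C] [RigData C] [IsRigCategory C] :
    C ⥤ Completion C where
  obj A := ⟨A⟩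
  map {A B} f := (Hom.mk ((RigData.add.right A).hom ≫ f) : Hom A B)
  map_id A := by simp only [Category.comp_id]; rfl
  map_comp {A B D} f g := by
    refine (Hom.mk_eq (A := A) (B := D) _ _ (RigData.add.left (zero C)).inv ?_).symm
    have ha := IsRigCategory.isAdd (C := C)
    rw [← reassoc_of% ha.right_natural]
    exact ha.comp_right_unitor f _

/-- The sum and product of the completion; all coherence isomorphisms are the images of those
of `C`. -/
instance : RigData (Completion C) where
  add :=
    { obj := fun A B => ⟨A.of ⊞ B.of⟩
      hom := fun f g => Hom.add f g
      one := ⟨zero C⟩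
      assoc := fun A B D => (inclFunctor C).mapIso (RigData.add.assoc A.of B.of D.of)
      left := fun A => (inclFunctor C).mapIso (RigData.add.left A.of)
      right := fun A => (inclFunctor C).mapIso (RigData.add.right A.of)
      symm := fun A B => (inclFunctor C).mapIso (RigData.add.symm A.of B.of) }
  mul :=
    { obj := fun A B => ⟨A.of ⊠ B.of⟩
      hom := fun f g => Hom.mul f g
      one := ⟨unit C⟩
      assoc := fun A B D => (inclFunctor C).mapIso (RigData.mul.assoc A.of B.of D.of)
      left := fun A => (inclFunctor C).mapIso (RigData.mul.left A.of)
      right := fun A => (inclFunctor C).mapIso (RigData.mul.right A.of)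
      symm := fun A B => (inclFunctor C).mapIso (RigData.mul.symm A.of B.of) }
  distrib A B D := (inclFunctor C).mapIso (RigData.distrib A.of B.of D.of)
  annih A := (inclFunctor C).mapIso (RigData.annih A.of)

/-- `inclFunctor` as a strict rig functor: its comparison isomorphisms are identities. -/
def incl (C : Type u) [Category.{v} C] [RigData C] [IsRigCategory C] :
    RigFunctorData C (Completion C) where
  toFunctor := inclFunctor C
  addComp :=
    { μ := fun A B => Iso.refl (⟨A ⊞ B⟩ : Completion C)
      ε := Iso.refl (⟨zero C⟩ : Completion C) }
  mulComp :=
    { μ := fun A B => Iso.refl (⟨A ⊠ B⟩ : Completion C)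
      ε := Iso.refl (⟨unit C⟩ : Completion C) }

end Completion

end Rig

/-! Every morphism `[f : A ⊞ H ⟶ B]` of the completion factors as the injection `inl A H = [𝟙]`
followed by the image of `f` (`homMk_eq_inl_comp`), and `inl A H` is itself `ρ⁻¹` followed by the
sum of `𝟙` and the map `0 ⟶ H` (`inl_eq`). So the completion is generated by `C` together with maps
out of `0`. These are unique because a map out of `0 ⊞ H` is the same as a map out of `H`, which can
serve as a mediator (`zero_hom_ext`).

The coherence isomorphisms of the completion come from `C` along a functor that is strict for both
sums and products. Laws that mention only coherence maps are therefore inherited; what needs proof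
is functoriality and naturality with respect to the new morphisms. In each case a mediator between
the two heaps is found, usually the corresponding coherence map at the heaps. For the product, the
key fact is that `mulHom f g` is the composite of its two whiskerings in either order
(`mulHom_eq_left_right`, `mulHom_eq_right_left`). Everything about `⊠` then reduces to whiskerings,
where annihilators shrink the three-term heap to one term and Laplaza's axioms apply directly.

For a coaffine target, sums have injections `A ⟶ A ⊞ H`, compatible with associators, sums and
products because maps out of objects isomorphic to `0` are unique. The extension sends `[f]` to `F A
⟶ F A ⊞ F H ≅ F (A ⊞ H) ⟶ F B` (`liftMap`). It is forced, since a rig functor on the completion must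
preserve injections (`map_inl`). -/

theorem CategoryTheory.MonoidalCategory.rightUnitor_inv_tensorμ_leftUnitor {C : Type u}
    [Category.{v} C] [MonoidalCategory C] [BraidedCategory C] (A B : C) :
    (ρ_ A).inv ▷ (𝟙_ C ⊗ B) ≫ tensorμ A (𝟙_ C) (𝟙_ C) B ≫ ((ρ_ A).hom ⊗ₘ (λ_ B).hom) =
      A ◁ (λ_ B).hom := by
  simp only [tensorμ, MonoidalCategory.tensorHom_def, braiding_tensorUnit_left]
  monoidal

namespace Rig

open RigData IsRigCategory

local infixr:65 " ⊞ " => SymMonData.obj add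
local infixr:70 " ⊠ " => SymMonData.obj mul
local infixr:65 " ⊞ₕ " => SymMonData.hom add
local infixr:70 " ⊠ₕ " => SymMonData.hom mul

/-! ### Coherence of the middle-four interchange. -/

namespace SymMonData.IsSymMon

variable {C : Type u} [Category.{v} C] {S : SymMonData C} (h : S.IsSymMon)
include h

theorem hom_left_right {A A' B B' : C} (f : A ⟶ A') (g : B ⟶ B') :
    S.hom f g = S.hom f (𝟙 B) ≫ S.hom (𝟙 A') g := by
  rw [← h.hom_comp, Category.comp_id, Category.id_comp]

theorem hom_right_left {A A' B B' : C} (f : A ⟶ A') (g : B ⟶ B') :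
    S.hom f g = S.hom (𝟙 A) g ≫ S.hom f (𝟙 B') := by
  rw [← h.hom_comp, Category.comp_id, Category.id_comp]

theorem left_one : (S.left S.one).hom = (S.right S.one).hom := by
  let _ := h.toMonoidalCategory
  exact unitors_equal

theorem mid_right (A B : C) :
    (S.right (S.obj A B)).hom = S.hom (𝟙 _) (S.left S.one).inv ≫ S.mid A B S.one S.one ≫
      S.hom (S.right A).hom (S.right B).hom := by
  let _ := h.toMonoidalCategory
  let _ := h.toSymmetricCategory
  exact tensor_right_unitality A B

theorem mid_assoc (A B D E K L : C) :
    S.hom (S.mid A B D E) (𝟙 (S.obj K L)) ≫ S.mid (S.obj A D) (S.obj B E) K L ≫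
        S.hom (S.assoc A D K).hom (S.assoc B E L).hom =
      (S.assoc (S.obj A B) (S.obj D E) (S.obj K L)).hom ≫
        S.hom (𝟙 _) (S.mid D E K L) ≫ S.mid A B (S.obj D K) (S.obj E L) := by
  let _ := h.toMonoidalCategory
  let _ := h.toSymmetricCategory
  exact tensor_associativity A B D E K L

theorem assoc_mid (A B D E K L : C) :
    S.mid (S.obj A B) D (S.obj E K) L ≫ S.hom (S.mid A B E K) (𝟙 _) ≫
        (S.assoc (S.obj A E) (S.obj B K) (S.obj D L)).hom =
      S.hom (S.assoc A B D).hom (S.assoc E K L).hom ≫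
        S.mid A (S.obj B D) E (S.obj K L) ≫ S.hom (𝟙 _) (S.mid B D K L) := by
  let _ := h.toMonoidalCategory
  let _ := h.toSymmetricCategory
  exact associator_monoidal A B D E K L

theorem left_mid (A B : C) :
    S.hom (S.left A).hom (S.left B).hom =
      S.mid S.one A S.one B ≫ S.hom (S.left S.one).hom (𝟙 _) ≫ (S.left (S.obj A B)).hom := by
  let _ := h.toMonoidalCategory
  let _ := h.toSymmetricCategory
  exact leftUnitor_monoidal A B

theorem right_mid (A B : C) :
    S.hom (S.right A).hom (S.right B).hom =
      S.mid A S.one B S.one ≫ S.hom (𝟙 _) (S.left S.one).hom ≫ (S.right (S.obj A B)).hom := by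
  let _ := h.toMonoidalCategory
  let _ := h.toSymmetricCategory
  exact rightUnitor_monoidal A B

theorem symm_mid (A B D E : C) :
    S.mid A B D E ≫ (S.symm (S.obj A D) (S.obj B E)).hom =
      S.hom (S.symm A B).hom (S.symm D E).hom ≫ S.mid B A E D := by
  let _ := h.toMonoidalCategory
  let _ := h.toSymmetricCategory
  have : tensorμ A B D E ≫ (β_ (A ⊗ D) (B ⊗ E)).hom =
      ((β_ A B).hom ⊗ₘ (β_ D E).hom) ≫ tensorμ B A E D := by
    -- Symmetry enters twice: one braiding of `A` and `E` is rewritten as the inverse of the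
    -- opposite one, and in `key` the braiding of `B` past `D` cancels against its opposite.
    simp [tensorμ, SymmetricCategory.braiding_swap_eq_inv_braiding E A,
      MonoidalCategory.tensorHom_def]
    have key : A ◁ (β_ B D).hom ▷ E ≫ A ◁ (β_ D B).hom ▷ E = 𝟙 _ := by
      rw [← MonoidalCategory.whiskerLeft_comp, ← comp_whiskerRight, SymmetricCategory.symmetry]
      simp
    rw [reassoc_of% key]
    monoidal
  exact this

theorem mid_mid (A B D E : C) : S.mid A B D E ≫ S.mid A D B E = 𝟙 _ := by
  let _ := h.toMonoidalCategory
  let _ := h.toSymmetricCategory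
  have : tensorμ A B D E ≫ tensorμ A D B E = 𝟙 _ := by
    have key : A ◁ (β_ B D).hom ▷ E ≫ A ◁ (β_ D B).hom ▷ E = 𝟙 _ := by
      rw [← MonoidalCategory.whiskerLeft_comp, ← comp_whiskerRight, SymmetricCategory.symmetry]
      simp
    simp [tensorμ, reassoc_of% key]
  exact this

/-- `mid_assoc` solved for the other interchange, which is possible because `mid_mid` makes the
interchange its own inverse. This is the form needed for composites with heaps. -/
theorem mid_assoc_inv (A B D E K L : C) :
    S.mid A B (S.obj D K) (S.obj E L) ≫ S.hom (S.assoc A D K).inv (S.assoc B E L).inv =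
      S.hom (𝟙 _) (S.mid D K E L) ≫ (S.assoc (S.obj A B) (S.obj D E) (S.obj K L)).inv ≫
        S.hom (S.mid A B D E) (𝟙 (S.obj K L)) ≫ S.mid (S.obj A D) (S.obj B E) K L := by
  have e := (S.hom (𝟙 (S.obj A B)) (S.mid D K E L) ≫
    (S.assoc (S.obj A B) (S.obj D E) (S.obj K L)).inv) ≫= h.mid_assoc A B D E K L =≫
      S.hom (S.assoc A D K).inv (S.assoc B E L).inv
  simp only [Category.assoc, ← h.hom_comp, Iso.hom_inv_id, h.hom_id, Category.comp_id,
    Iso.inv_hom_id_assoc] at e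
  rw [e, ← reassoc_of% h.hom_comp, h.mid_mid]
  simp [h.hom_id]

end SymMonData.IsSymMon

/-! ### Morphisms with a heap and the sum of the completion. -/

namespace Completion

variable {C : Type u} [Category.{v} C] [RigData C] [IsRigCategory C]

/-- The class of `f : A ⊞ H ⟶ B` as a morphism of the completion. -/
def homMk {A B H : C} (f : A ⊞ H ⟶ B) : (⟨A⟩ : Completion C) ⟶ ⟨B⟩ := Hom.mk f

/-- A morphism of `C` as a morphism of the completion. -/
def inc {A B : C} (f : A ⟶ B) : (⟨A⟩ : Completion C) ⟶ ⟨B⟩ := homMk ((add.right A).hom ≫ f)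

/-- The sum of morphisms of the completion. -/
def addHom {A A' B B' : C} (f : (⟨A⟩ : Completion C) ⟶ ⟨B⟩) (f' : (⟨A'⟩ : Completion C) ⟶ ⟨B'⟩) :
    (⟨A ⊞ A'⟩ : Completion C) ⟶ ⟨B ⊞ B'⟩ := Hom.add f f'

/-- The product of morphisms of the completion. -/
def mulHom {A A' B B' : C} (f : (⟨A⟩ : Completion C) ⟶ ⟨B⟩) (f' : (⟨A'⟩ : Completion C) ⟶ ⟨B'⟩) :
    (⟨A ⊠ A'⟩ : Completion C) ⟶ ⟨B ⊠ B'⟩ := Hom.mul f f'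

/-- Equalities of classes below come down to naming a mediator `h` and checking an equation in `C`.
-/
theorem homMk_eq {A B H H' : C} (f : A ⊞ H ⟶ B) (f' : A ⊞ H' ⟶ B) (h : H' ⟶ H)
    (e : f' = (𝟙 A ⊞ₕ h) ≫ f) : homMk f' = homMk f :=
  (Hom.mk_eq f f' h e).symm

@[elab_as_elim]
theorem hom_ind {A B : C} {P : ((⟨A⟩ : Completion C) ⟶ ⟨B⟩) → Prop}
    (h : ∀ (H : C) (f : A ⊞ H ⟶ B), P (homMk f)) (f : (⟨A⟩ : Completion C) ⟶ ⟨B⟩) : P f :=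
  Hom.ind h f

theorem homMk_comp {A B D H K : C} (f : A ⊞ H ⟶ B) (g : B ⊞ K ⟶ D) :
    homMk f ≫ homMk g = homMk ((add.assoc A H K).inv ≫ (f ⊞ₕ 𝟙 K) ≫ g) := rfl

/-- A morphism of `C` carries the heap `0`, which a unitor absorbs; composing with it on either side
keeps the other heap unchanged. -/
theorem homMk_comp_inc {A B D H : C} (f : A ⊞ H ⟶ B) (g : B ⟶ D) :
    homMk f ≫ inc g = homMk (f ≫ g) :=
  (homMk_eq _ _ (add.right H).inv (IsRigCategory.isAdd.comp_right_unitor' f g)).symm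

theorem inc_comp_homMk {A B D H : C} (f : A ⟶ B) (g : B ⊞ H ⟶ D) :
    inc f ≫ homMk g = homMk ((f ⊞ₕ 𝟙 H) ≫ g) :=
  (homMk_eq _ _ (add.left H).inv (IsRigCategory.isAdd.comp_right_unitor f g)).symm

@[simp]
theorem inc_id (A : C) : inc (𝟙 A) = 𝟙 _ := (inclFunctor C).map_id A

theorem inc_comp {A B D : C} (f : A ⟶ B) (g : B ⟶ D) : inc (f ≫ g) = inc f ≫ inc g :=
  (inclFunctor C).map_comp f g

theorem addHom_homMk {A A' B B' H H' : C} (f : A ⊞ H ⟶ B) (f' : A' ⊞ H' ⟶ B') :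
    addHom (homMk f) (homMk f') = homMk (RigData.add.mid A A' H H' ≫ (f ⊞ₕ f')) := rfl

/-- Up to the left unitor, `f : 0 ⊞ H ⟶ A` is a map `H ⟶ A`. That map mediates between `f` and the
left unitor of `A`, taken with heap `A`, so all classes coincide. -/
theorem zero_hom_ext {A : C} (f g : (⟨zero C⟩ : Completion C) ⟶ ⟨A⟩) : f = g := by
  have ha := IsRigCategory.isAdd (C := C)
  suffices ∀ f : (⟨zero C⟩ : Completion C) ⟶ ⟨A⟩, f = homMk (add.left A).hom by
    rw [this f, this g]
  intro f
  induction f using hom_ind with | h H f => ?_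
  refine homMk_eq _ _ ((add.left H).inv ≫ f) ?_
  rw [ha.left_natural, Iso.hom_inv_id_assoc]

theorem isCoaffine : IsCoaffine (Completion C) := fun A =>
  ⟨{ default := homMk (add.left A.of).hom
     uniq _ := zero_hom_ext _ _ }⟩

theorem addHom_inc {A A' B B' : C} (f : A ⟶ B) (g : A' ⟶ B') :
    addHom (inc f) (inc g) = inc (f ⊞ₕ g) := by
  have ha := IsRigCategory.isAdd (C := C)
  simp only [inc, addHom_homMk]
  refine (homMk_eq _ _ (add.left (zero C)).inv ?_).symm
  rw [ha.hom_comp, ha.mid_right]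
  simp

theorem addHom_id (A B : C) : addHom (𝟙 (⟨A⟩ : Completion C)) (𝟙 (⟨B⟩ : Completion C)) = 𝟙 _ := by
  rw [← inc_id, ← inc_id, addHom_inc, IsRigCategory.isAdd.hom_id, inc_id]

theorem addHom_comp {A A' A'' B B' B'' : C} (f : (⟨A⟩ : Completion C) ⟶ ⟨A'⟩)
    (f' : (⟨A'⟩ : Completion C) ⟶ ⟨A''⟩) (g : (⟨B⟩ : Completion C) ⟶ ⟨B'⟩)
    (g' : (⟨B'⟩ : Completion C) ⟶ ⟨B''⟩) :
    addHom (f ≫ f') (g ≫ g') = addHom f g ≫ addHom f' g' := by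
  have ha := IsRigCategory.isAdd (C := C)
  induction f using hom_ind with | h H f => ?_
  induction f' using hom_ind with | h H' f' => ?_
  induction g using hom_ind with | h K g => ?_
  induction g' using hom_ind with | h K' g' => ?_
  simp only [homMk_comp, addHom_homMk]
  -- The left side has heap `(H ⊞ H') ⊞ (K ⊞ K')`, the right side `(H ⊞ K) ⊞ (H' ⊞ K')`.
  refine homMk_eq _ _ (RigData.add.mid H H' K K') ?_
  have e : ((RigData.add.mid A B H K ≫ (f ⊞ₕ g)) ⊞ₕ 𝟙 (H' ⊞ K')) =
      (RigData.add.mid A B H K ⊞ₕ 𝟙 _) ≫ ((f ⊞ₕ g) ⊞ₕ (𝟙 H' ⊞ₕ 𝟙 K')) := by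
    rw [← ha.hom_comp, Category.id_comp, ha.hom_id]
  rw [e, Category.assoc, reassoc_of% ha.mid_natural, ha.hom_comp, ha.hom_comp,
    reassoc_of% ha.mid_assoc_inv]

/-- The canonical morphism `A ⟶ A ⊞ H` of the completion. -/
def inl (A H : C) : (⟨A⟩ : Completion C) ⟶ ⟨A ⊞ H⟩ := homMk (𝟙 (A ⊞ H))

/-- The normal form on which uniqueness of the extension rests. -/
theorem homMk_eq_inl_comp {A B H : C} (f : A ⊞ H ⟶ B) : homMk f = inl A H ≫ inc f := by
  rw [inl, homMk_comp_inc, Category.id_comp]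

/-- In this and the following naturality lemmas the mediator is the same coherence map, taken at the
heaps. -/
theorem addHom_assoc {A A' B B' D D' : C} (f : (⟨A⟩ : Completion C) ⟶ ⟨A'⟩)
    (g : (⟨B⟩ : Completion C) ⟶ ⟨B'⟩) (h : (⟨D⟩ : Completion C) ⟶ ⟨D'⟩) :
    addHom (addHom f g) h ≫ inc (add.assoc A' B' D').hom =
      inc (add.assoc A B D).hom ≫ addHom f (addHom g h) := by
  have ha := IsRigCategory.isAdd (C := C)
  induction f using hom_ind with | h H f => ?_
  induction g using hom_ind with | h K g => ?_
  induction h using hom_ind with | h L h => ?_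
  simp only [homMk_comp_inc, inc_comp_homMk, addHom_homMk]
  refine homMk_eq _ _ (add.assoc H K L).hom ?_
  have e₁ : ((RigData.add.mid A B H K ≫ (f ⊞ₕ g)) ⊞ₕ h) =
      (RigData.add.mid A B H K ⊞ₕ 𝟙 _) ≫ ((f ⊞ₕ g) ⊞ₕ h) := by
    rw [← ha.hom_comp, Category.id_comp]
  have e₂ : (f ⊞ₕ (RigData.add.mid B D K L ≫ (g ⊞ₕ h))) =
      (𝟙 _ ⊞ₕ RigData.add.mid B D K L) ≫ (f ⊞ₕ (g ⊞ₕ h)) := by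
    rw [← ha.hom_comp, Category.id_comp]
  rw [e₁, e₂, Category.assoc, Category.assoc, ha.assoc_natural, reassoc_of% ha.assoc_mid,
    ← reassoc_of% ha.hom_comp]
  simp

theorem addHom_left {A A' : C} (f : (⟨A⟩ : Completion C) ⟶ ⟨A'⟩) :
    addHom (𝟙 _) f ≫ inc (add.left A').hom = inc (add.left A).hom ≫ f := by
  have ha := IsRigCategory.isAdd (C := C)
  induction f using hom_ind with | h H f => ?_
  rw [← inc_id, inc]
  simp only [homMk_comp_inc, inc_comp_homMk, addHom_homMk]
  refine homMk_eq _ _ (add.left H).hom ?_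
  -- The identity of `0` is the class of the right unitor of `0`, while `left_mid` involves the left
  -- one; `left_one` identifies them.
  rw [Category.comp_id, ha.hom_left_right, Category.assoc, Category.assoc, ha.left_natural,
    ← reassoc_of% ha.hom_comp, Category.id_comp, Category.comp_id, ha.left_mid,
    ← ha.left_one]
  simp

theorem addHom_right {A A' : C} (f : (⟨A⟩ : Completion C) ⟶ ⟨A'⟩) :
    addHom f (𝟙 _) ≫ inc (add.right A').hom = inc (add.right A).hom ≫ f := by
  have ha := IsRigCategory.isAdd (C := C)
  induction f using hom_ind with | h H f => ?_
  rw [← inc_id, inc]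
  simp only [homMk_comp_inc, inc_comp_homMk, addHom_homMk]
  refine homMk_eq _ _ (add.right H).hom ?_
  rw [Category.comp_id, ha.hom_right_left, Category.assoc, Category.assoc, ha.right_natural,
    ← reassoc_of% ha.hom_comp, Category.id_comp, Category.comp_id, ha.right_mid,
    ← ha.left_one]
  simp

theorem addHom_symm {A A' B B' : C} (f : (⟨A⟩ : Completion C) ⟶ ⟨A'⟩)
    (g : (⟨B⟩ : Completion C) ⟶ ⟨B'⟩) :
    addHom f g ≫ inc (add.symm A' B').hom = inc (add.symm A B).hom ≫ addHom g f := by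
  have ha := IsRigCategory.isAdd (C := C)
  induction f using hom_ind with | h H f => ?_
  induction g using hom_ind with | h K g => ?_
  simp only [homMk_comp_inc, inc_comp_homMk, addHom_homMk]
  refine homMk_eq _ _ (add.symm H K).hom ?_
  rw [Category.assoc, ha.symm_natural, reassoc_of% ha.symm_mid, ← reassoc_of% ha.hom_comp]
  simp

theorem add_isSymMon : (add : SymMonData (Completion C)).IsSymMon where
  hom_id A B := addHom_id A.of B.of
  hom_comp f f' g g' := addHom_comp f f' g g'
  assoc_natural f g h := addHom_assoc f g h
  left_natural f := addHom_left f
  right_natural f := addHom_right f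
  symm_natural f g := addHom_symm f g
  pentagon A B D E := by
    have ha := IsRigCategory.isAdd (C := C)
    -- Only coherence maps occur, so the law is the image of the one in `C` under the strict functor
    -- `inc`.
    have := congr_arg inc (ha.pentagon A.of B.of D.of E.of)
    simp only [inc_comp, ← addHom_inc, inc_id] at this
    exact this
  triangle A B := by
    have ha := IsRigCategory.isAdd (C := C)
    have := congr_arg inc (ha.triangle A.of B.of)
    simp only [inc_comp, ← addHom_inc, inc_id] at this
    exact this
  hexagon A B D := by
    have ha := IsRigCategory.isAdd (C := C)
    have := congr_arg inc (ha.hexagon A.of B.of D.of)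
    simp only [inc_comp, ← addHom_inc, inc_id] at this
    exact this
  symmetry A B := by
    have ha := IsRigCategory.isAdd (C := C)
    have := congr_arg inc (ha.symmetry A.of B.of)
    simp only [inc_comp, inc_id] at this
    exact this

end Completion

/-! ### Whiskering identities, and Laplaza's axioms for inverse distributors. -/

namespace SymMonData.IsSymMon

variable {C : Type u} [Category.{v} C] {S : SymMonData C} (h : S.IsSymMon)
include h

theorem comp_hom_id {A A' A'' : C} (f : A ⟶ A') (f' : A' ⟶ A'') (B : C) :
    S.hom (f ≫ f') (𝟙 B) = S.hom f (𝟙 B) ≫ S.hom f' (𝟙 B) := by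
  rw [← h.hom_comp, Category.comp_id]

theorem id_hom_comp {A A' A'' : C} (B : C) (f : A ⟶ A') (f' : A' ⟶ A'') :
    S.hom (𝟙 B) (f ≫ f') = S.hom (𝟙 B) f ≫ S.hom (𝟙 B) f' := by
  rw [← h.hom_comp, Category.comp_id]

/-- A summand that maps to the unit can be discarded before or after reassociating. This and the
next lemma remove annihilated parts of heaps. -/
theorem assoc_inv_right {A B D : C} (k : D ⟶ S.one) :
    (S.assoc A B D).inv ≫ S.hom (𝟙 _) k ≫ (S.right (S.obj A B)).hom =
      S.hom (𝟙 A) (S.hom (𝟙 B) k ≫ (S.right B).hom) := by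
  let _ := h.toMonoidalCategory
  have : ∀ k : D ⟶ 𝟙_ C, (α_ A B D).inv ≫ (A ⊗ B) ◁ k ≫ (ρ_ (A ⊗ B)).hom =
      A ◁ (B ◁ k ≫ (ρ_ B).hom) := by simp
  exact this k

theorem assoc_inv_left {A B D D' : C} (k : B ⟶ S.one) (l : D ⟶ D') :
    (S.assoc A B D).inv ≫ S.hom (S.hom (𝟙 A) k ≫ (S.right A).hom) l =
      S.hom (𝟙 A) (S.hom k l ≫ (S.left D').hom) := by
  let _ := h.toMonoidalCategory
  have : ∀ k : B ⟶ 𝟙_ C, (α_ A B D).inv ≫ ((A ◁ k ≫ (ρ_ A).hom) ⊗ₘ l) =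
      A ◁ ((k ⊗ₘ l) ≫ (λ_ D').hom) := by
    simp [MonoidalCategory.tensorHom_def]
  exact this k

end SymMonData.IsSymMon

section

variable {C : Type u} [Category.{v} C] [RigData C] [IsRigCategory C]

/-- The right distributor as an isomorphism. -/
@[simps]
def rdistribIso (A B D : C) : (A ⊞ B) ⊠ D ≅ (A ⊠ D) ⊞ (B ⊠ D) where
  hom := rdistrib A B D
  inv := rdistribInv A B D
  hom_inv_id := Completion.rdistrib_rdistribInv A B D
  inv_hom_id := Completion.rdistribInv_rdistrib A B D

theorem distrib_inv_right (A B : C) :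
    (distrib A B (zero C)).inv ≫ (𝟙 A ⊠ₕ (add.right B).hom) =
      (𝟙 (A ⊠ B) ⊞ₕ (annih A).hom) ≫ (add.right (A ⊠ B)).hom := by
  rw [← distrib_add_right, Iso.inv_hom_id_assoc]

theorem rdistribInv_right (A B : C) :
    rdistribInv A (zero C) B ≫ ((add.right A).hom ⊠ₕ 𝟙 B) =
      (𝟙 (A ⊠ B) ⊞ₕ lannih B) ≫ (add.right (A ⊠ B)).hom := by
  rw [← rdistrib_add_right]
  exact (rdistribIso A (zero C) B).inv_hom_id_assoc _

theorem rdistribInv_assoc_inv (A H K D : C) :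
    rdistribInv A (H ⊞ K) D ≫ ((add.assoc A H K).inv ⊠ₕ 𝟙 D) =
      (𝟙 _ ⊞ₕ rdistrib H K D) ≫ (add.assoc (A ⊠ D) (H ⊠ D) (K ⊠ D)).inv ≫
        (rdistribInv A H D ⊞ₕ 𝟙 _) ≫ rdistribInv (A ⊞ H) K D := by
  have ha := isAdd (C := C)
  have hm := isMul (C := C)
  have e := rdistrib_add_assoc A H K D
  rw [← rdistribIso_hom, ← rdistribIso_hom, ← rdistribIso_hom, ← rdistribIso_hom] at e
  rw [← rdistribIso_inv, ← rdistribIso_inv, ← rdistribIso_inv, ← rdistribIso_hom]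
  rw [Iso.inv_comp_eq]
  have e' := ((add.assoc A H K).inv ⊠ₕ 𝟙 D) ≫= e
  rw [← reassoc_of% hm.comp_hom_id, Iso.inv_hom_id, hm.hom_id, Category.id_comp] at e'
  rw [← reassoc_of% e', Iso.hom_inv_id_assoc, ← reassoc_of% ha.comp_hom_id, Iso.hom_inv_id,
    ha.hom_id, Category.id_comp, Iso.hom_inv_id, Category.comp_id]

theorem distrib_inv_assoc_inv (A B H K : C) :
    (distrib A B (H ⊞ K)).inv ≫ (𝟙 A ⊠ₕ (add.assoc B H K).inv) =
      (𝟙 _ ⊞ₕ (distrib A H K).hom) ≫ (add.assoc (A ⊠ B) (A ⊠ H) (A ⊠ K)).inv ≫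
        ((distrib A B H).inv ⊞ₕ 𝟙 _) ≫ (distrib A (B ⊞ H) K).inv := by
  have ha := isAdd (C := C)
  have hm := isMul (C := C)
  have e := distrib_add_assoc A B H K
  rw [Iso.inv_comp_eq]
  have e' := (𝟙 A ⊠ₕ (add.assoc B H K).inv) ≫= e
  rw [← reassoc_of% hm.id_hom_comp, Iso.inv_hom_id, hm.hom_id, Category.id_comp] at e'
  rw [← reassoc_of% e', Iso.hom_inv_id_assoc, ← reassoc_of% ha.comp_hom_id, Iso.hom_inv_id,
    ha.hom_id, Category.id_comp, Iso.hom_inv_id, Category.comp_id]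

theorem distrib_inv_assoc (A B H K : C) :
    ((distrib A B H).inv ⊞ₕ 𝟙 _) ≫ (distrib A (B ⊞ H) K).inv ≫ (𝟙 A ⊠ₕ (add.assoc B H K).hom) =
      (add.assoc (A ⊠ B) (A ⊠ H) (A ⊠ K)).hom ≫ (𝟙 _ ⊞ₕ (distrib A H K).inv) ≫
        (distrib A B (H ⊞ K)).inv := by
  have ha := isAdd (C := C)
  have e := distrib_add_assoc A B H K
  have key : (𝟙 A ⊠ₕ (add.assoc B H K).hom) = (distrib A (B ⊞ H) K).hom ≫
      ((distrib A B H).hom ⊞ₕ 𝟙 _) ≫ (add.assoc (A ⊠ B) (A ⊠ H) (A ⊠ K)).hom ≫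
        (𝟙 _ ⊞ₕ (distrib A H K).inv) ≫ (distrib A B (H ⊞ K)).inv := by
    rw [reassoc_of% e, ← reassoc_of% ha.id_hom_comp, Iso.hom_inv_id, ha.hom_id,
      Category.id_comp, Iso.hom_inv_id, Category.comp_id]
  rw [key, Iso.inv_hom_id_assoc, ← reassoc_of% ha.comp_hom_id, Iso.inv_hom_id, ha.hom_id,
    Category.id_comp]

/-- The inverse form of `distrib_rdistrib`; the middle arguments of `mid` are exchanged because
`mid` is inverted by `mid_mid`. -/
theorem rdistribInv_distrib_inv (A B D E : C) :
    (rdistribInv A B D ⊞ₕ rdistribInv A B E) ≫ (distrib (A ⊞ B) D E).inv =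
      add.mid (A ⊠ D) (B ⊠ D) (A ⊠ E) (B ⊠ E) ≫
        ((distrib A D E).inv ⊞ₕ (distrib B D E).inv) ≫ rdistribInv A B (D ⊞ E) := by
  have ha := isAdd (C := C)
  have e := distrib_rdistrib A B D E
  have key : (distrib (A ⊞ B) D E).inv = (rdistrib A B D ⊞ₕ rdistrib A B E) ≫
      add.mid (A ⊠ D) (B ⊠ D) (A ⊠ E) (B ⊠ E) ≫
        ((distrib A D E).inv ⊞ₕ (distrib B D E).inv) ≫ rdistribInv A B (D ⊞ E) := by
    rw [← Category.comp_id (distrib (A ⊞ B) D E).inv, Iso.inv_comp_eq, reassoc_of% e,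
      reassoc_of% ha.mid_mid, ← reassoc_of% ha.hom_comp,
      Iso.hom_inv_id, Iso.hom_inv_id, ha.hom_id, Category.id_comp,
      Completion.rdistrib_rdistribInv]
  rw [key, ← reassoc_of% ha.hom_comp, Completion.rdistribInv_rdistrib,
    Completion.rdistribInv_rdistrib, ha.hom_id, Category.id_comp]

/-- Laplaza's axioms make `A ⊠ -` a braided lax monoidal functor for `⊞`, with structure maps the
inverse distributors and annihilator, and such a functor respects the interchange. -/
theorem distrib_inv_mid (A B D H K : C) :
    (distrib A (B ⊞ D) (H ⊞ K)).inv ≫ (𝟙 A ⊠ₕ add.mid B D H K) ≫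
        (distrib A (B ⊞ H) (D ⊞ K)).hom =
      ((distrib A B D).hom ⊞ₕ (distrib A H K).hom) ≫
        add.mid (A ⊠ B) (A ⊠ D) (A ⊠ H) (A ⊠ K) ≫
        ((distrib A B H).inv ⊞ₕ (distrib A D K).inv) := by
  have ha := isAdd (C := C)
  have hm := isMul (C := C)
  let _ := ha.toMonoidalCategory
  let _ := ha.toSymmetricCategory
  let F : C ⥤ C :=
    { obj X := A ⊠ X
      map f := 𝟙 A ⊠ₕ f
      map_id X := hm.hom_id A X
      map_comp f g := hm.id_hom_comp A f g }
  let _ : F.LaxMonoidal := Functor.LaxMonoidal.ofTensorHom (F := F) (annih A).inv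
    (fun X Y => (distrib A X Y).inv)
    (fun f g => Completion.distribInv_natural _ f g)
    (fun X Y Z => distrib_inv_assoc A X Y Z)
    (fun X => by
      have := distrib_add_left A X
      change (add.left (A ⊠ X)).hom = ((annih A).inv ⊞ₕ 𝟙 (A ⊠ X)) ≫ (distrib A (zero C) X).inv ≫
        (𝟙 A ⊠ₕ (add.left X).hom)
      rw [← this, Iso.inv_hom_id_assoc, ← reassoc_of% ha.comp_hom_id, Iso.inv_hom_id, ha.hom_id,
        Category.id_comp])
    (fun X => by
      have := distrib_add_right A X
      change (add.right (A ⊠ X)).hom = (𝟙 (A ⊠ X) ⊞ₕ (annih A).inv) ≫ (distrib A X (zero C)).inv ≫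
        (𝟙 A ⊠ₕ (add.right X).hom)
      rw [← this, Iso.inv_hom_id_assoc, ← reassoc_of% ha.id_hom_comp, Iso.inv_hom_id, ha.hom_id,
        Category.id_comp])
  let _ : F.LaxBraided := ⟨fun X Y => by
    change (distrib A X Y).inv ≫ (𝟙 A ⊠ₕ (add.symm X Y).hom) =
      (add.symm (A ⊠ X) (A ⊠ Y)).hom ≫ (distrib A Y X).inv
    rw [Iso.inv_comp_eq, reassoc_of% distrib_symm, Iso.hom_inv_id, Category.comp_id]⟩
  have e : add.mid (A ⊠ B) (A ⊠ D) (A ⊠ H) (A ⊠ K) ≫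
      ((distrib A B H).inv ⊞ₕ (distrib A D K).inv) ≫ (distrib A (B ⊞ H) (D ⊞ K)).inv =
      ((distrib A B D).inv ⊞ₕ (distrib A H K).inv) ≫ (distrib A (B ⊞ D) (H ⊞ K)).inv ≫
        (𝟙 A ⊠ₕ add.mid B D H K) :=
    tensorμ_comp_μ_tensorHom_μ_comp_μ F B D H K
  have e' := ((distrib A B D).hom ⊞ₕ (distrib A H K).hom) ≫= e =≫
    (distrib A (B ⊞ H) (D ⊞ K)).hom
  simp only [Category.assoc, Iso.inv_hom_id, Category.comp_id, ← reassoc_of% ha.hom_comp,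
    Iso.hom_inv_id, ha.hom_id, Category.id_comp] at e'
  exact e'.symm

end

/-! ### Whiskerings and bifunctoriality of the product. -/

namespace Completion

variable {C : Type u} [Category.{v} C] [RigData C] [IsRigCategory C]

theorem mulHom_homMk {A A' B B' H H' : C} (f : A ⊞ H ⟶ B) (f' : A' ⊞ H' ⟶ B') :
    mulHom (homMk f) (homMk f') = homMk (expandInv A H A' H' ≫ (f ⊠ₕ f')) := rfl

theorem id_eq_homMk (A : C) : 𝟙 (⟨A⟩ : Completion C) = homMk (add.right A).hom := rfl

theorem mulHom_homMk_id {A B H : C} (f : A ⊞ H ⟶ B) (D : C) :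
    mulHom (homMk f) (𝟙 (⟨D⟩ : Completion C)) = homMk (rdistribInv A H D ≫ (f ⊠ₕ 𝟙 D)) := by
  have ha := isAdd (C := C)
  have hm := isMul (C := C)
  rw [id_eq_homMk, mulHom_homMk]
  -- The identity has heap `0`, so the last heap summands `(A ⊠ 0) ⊞ (H ⊠ 0)` are collected into `(A
  -- ⊞ H) ⊠ 0` and annihilated.
  refine homMk_eq _ _ ((𝟙 _ ⊞ₕ (rdistribInv A H (zero C) ≫ (annih _).hom)) ≫
    (add.right _).hom) ?_
  rw [hm.hom_right_left, expandInv, Category.assoc, Category.assoc,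
    reassoc_of% distrib_inv_right, ← reassoc_of% ha.hom_comp, Category.comp_id,
    ← ha.assoc_inv_right, ha.hom_right_left]
  simp only [Category.assoc]
  rw [reassoc_of% ha.right_natural]

theorem mulHom_id_homMk {A' B' H' : C} (A : C) (f' : A' ⊞ H' ⟶ B') :
    mulHom (𝟙 (⟨A⟩ : Completion C)) (homMk f') =
      homMk ((distrib A A' H').inv ≫ (𝟙 A ⊠ₕ f')) := by
  have ha := isAdd (C := C)
  have hm := isMul (C := C)
  rw [id_eq_homMk, mulHom_homMk]
  -- The summand `0 ⊠ A'` is annihilated, and `(A ⊠ H') ⊞ (0 ⊠ H')` is collected into `(A ⊞ 0) ⊠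
  -- H'`, that is `A ⊠ H'`.
  refine homMk_eq _ _ ((lannih A' ⊞ₕ (rdistribInv A (zero C) H' ≫ ((add.right A).hom ⊠ₕ 𝟙 H'))) ≫
    (add.left _).hom) ?_
  rw [← ha.assoc_inv_left, hm.hom_left_right, expandInv, Category.assoc, Category.assoc,
    ← ha.hom_id, ← reassoc_of% distribInv_natural, ← reassoc_of% ha.hom_comp,
    rdistribInv_right]
  simp only [Category.assoc]

/-- The composite of whiskerings has the smaller heap `(H ⊠ B) ⊞ (A' ⊠ K)`. The mediator collects
`(A ⊠ K) ⊞ (H ⊠ K)` into `(A ⊞ H) ⊠ K` and runs `f` there, so in general it is not invertible. -/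
theorem mulHom_eq_left_right {A A' B B' : C} (f : (⟨A⟩ : Completion C) ⟶ ⟨A'⟩)
    (g : (⟨B⟩ : Completion C) ⟶ ⟨B'⟩) :
    mulHom f g = mulHom f (𝟙 _) ≫ mulHom (𝟙 _) g := by
  have ha := isAdd (C := C)
  have hm := isMul (C := C)
  induction f using hom_ind with | h H f => ?_
  induction g using hom_ind with | h K g => ?_
  rw [mulHom_homMk, mulHom_homMk_id, mulHom_id_homMk, homMk_comp]
  refine homMk_eq _ _ (𝟙 _ ⊞ₕ (rdistribInv A H K ≫ (f ⊠ₕ 𝟙 _))) ?_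
  rw [reassoc_of% ha.assoc_inv_natural, ← reassoc_of% ha.hom_comp, ha.hom_id, Category.id_comp,
    Category.comp_id, ha.hom_comp, Category.assoc, reassoc_of% distribInv_natural,
    hm.hom_left_right, expandInv, ha.hom_id]
  simp only [Category.assoc]

theorem mulHom_eq_right_left {A A' B B' : C} (f : (⟨A⟩ : Completion C) ⟶ ⟨A'⟩)
    (g : (⟨B⟩ : Completion C) ⟶ ⟨B'⟩) :
    mulHom f g = mulHom (𝟙 _) g ≫ mulHom f (𝟙 _) := by
  have ha := isAdd (C := C)
  have hm := isMul (C := C)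
  induction f using hom_ind with | h H f => ?_
  induction g using hom_ind with | h K g => ?_
  rw [mulHom_homMk, mulHom_homMk_id, mulHom_id_homMk, homMk_comp]
  -- The target heap is `(A ⊠ K) ⊞ (H ⊠ B')`: the summand `A ⊠ K` is moved to the front, then `(H ⊠
  -- B) ⊞ (H ⊠ K)` is collected into `H ⊠ (B ⊞ K)` and `g` is run there.
  refine homMk_eq _ _ (((add.assoc _ _ _).inv ≫ ((add.symm _ _).hom ⊞ₕ 𝟙 _) ≫
    (add.assoc _ _ _).hom) ≫ (𝟙 _ ⊞ₕ ((distrib H B K).inv ≫ (𝟙 _ ⊠ₕ g)))) ?_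
  rw [ha.id_hom_comp, Category.assoc, reassoc_of% ha.assoc_inv_natural, ha.hom_id,
    ← reassoc_of% ha.hom_comp, Category.id_comp, Category.comp_id, ha.hom_comp, Category.assoc,
    reassoc_of% rdistribInv_natural, expandInv, hm.hom_right_left, ha.hom_id]
  simp only [Category.assoc]
  rw [reassoc_of% rdistribInv_distrib_inv]
  simp only [SymMonData.mid, ha.id_hom_comp, Category.assoc, Iso.inv_hom_id_assoc]

theorem mulHom_comp_id {A A' A'' : C} (f : (⟨A⟩ : Completion C) ⟶ ⟨A'⟩)
    (f' : (⟨A'⟩ : Completion C) ⟶ ⟨A''⟩) (D : C) :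
    mulHom (f ≫ f') (𝟙 (⟨D⟩ : Completion C)) = mulHom f (𝟙 _) ≫ mulHom f' (𝟙 _) := by
  have ha := isAdd (C := C)
  have hm := isMul (C := C)
  induction f using hom_ind with | h H f => ?_
  induction f' using hom_ind with | h K f' => ?_
  simp only [homMk_comp, mulHom_homMk_id]
  refine homMk_eq _ _ (rdistrib H K D) ?_
  rw [hm.comp_hom_id, reassoc_of% rdistribInv_assoc_inv, ha.comp_hom_id, hm.comp_hom_id,
    Category.assoc, ← hm.hom_id K D, reassoc_of% rdistribInv_natural]

theorem mulHom_id_comp {A A' A'' : C} (D : C) (f : (⟨A⟩ : Completion C) ⟶ ⟨A'⟩)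
    (f' : (⟨A'⟩ : Completion C) ⟶ ⟨A''⟩) :
    mulHom (𝟙 (⟨D⟩ : Completion C)) (f ≫ f') = mulHom (𝟙 _) f ≫ mulHom (𝟙 _) f' := by
  have ha := isAdd (C := C)
  have hm := isMul (C := C)
  induction f using hom_ind with | h H f => ?_
  induction f' using hom_ind with | h K f' => ?_
  simp only [homMk_comp, mulHom_id_homMk]
  refine homMk_eq _ _ (distrib D H K).hom ?_
  rw [hm.id_hom_comp, reassoc_of% distrib_inv_assoc_inv, ha.comp_hom_id, hm.id_hom_comp,
    Category.assoc, ← hm.hom_id D K, reassoc_of% distribInv_natural]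

/-- After splitting into whiskerings, the two factorizations of `mulHom f' g` exchange the middle
factors. -/
theorem mulHom_comp {A A' A'' B B' B'' : C} (f : (⟨A⟩ : Completion C) ⟶ ⟨A'⟩)
    (f' : (⟨A'⟩ : Completion C) ⟶ ⟨A''⟩) (g : (⟨B⟩ : Completion C) ⟶ ⟨B'⟩)
    (g' : (⟨B'⟩ : Completion C) ⟶ ⟨B''⟩) :
    mulHom (f ≫ f') (g ≫ g') = mulHom f g ≫ mulHom f' g' := by
  rw [mulHom_eq_left_right (f ≫ f'), mulHom_comp_id, mulHom_id_comp, mulHom_eq_left_right f g,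
    mulHom_eq_left_right f' g', Category.assoc, Category.assoc, ← reassoc_of% mulHom_eq_right_left,
    ← reassoc_of% mulHom_eq_left_right]

theorem mulHom_inc_id {A B : C} (f : A ⟶ B) (D : C) :
    mulHom (inc f) (𝟙 (⟨D⟩ : Completion C)) = inc (f ⊠ₕ 𝟙 D) := by
  have hm := isMul (C := C)
  rw [inc, inc, mulHom_homMk_id]
  refine homMk_eq _ _ (lannih D) ?_
  rw [hm.comp_hom_id, reassoc_of% rdistribInv_right]

theorem mulHom_id_inc {A B : C} (D : C) (f : A ⟶ B) :
    mulHom (𝟙 (⟨D⟩ : Completion C)) (inc f) = inc (𝟙 D ⊠ₕ f) := by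
  have hm := isMul (C := C)
  rw [inc, inc, mulHom_id_homMk]
  refine homMk_eq _ _ (annih D).hom ?_
  rw [hm.id_hom_comp, reassoc_of% distrib_inv_right]

theorem mulHom_inc {A A' B B' : C} (f : A ⟶ B) (g : A' ⟶ B') :
    mulHom (inc f) (inc g) = inc (f ⊠ₕ g) := by
  rw [mulHom_eq_left_right, mulHom_inc_id, mulHom_id_inc, ← inc_comp, ← isMul.hom_left_right]

theorem mulHom_id (A B : C) : mulHom (𝟙 (⟨A⟩ : Completion C)) (𝟙 (⟨B⟩ : Completion C)) = 𝟙 _ := by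
  rw [← inc_id, ← inc_id, mulHom_inc, isMul.hom_id, inc_id]

end Completion

/-! ### Laplaza's multiplicative axioms for inverse distributors. -/

section

variable {C : Type u} [Category.{v} C] [RigData C] [IsRigCategory C]

theorem rdistribInv_mul_assoc (A B D E : C) :
    rdistribInv (A ⊠ D) (B ⊠ D) E ≫ (rdistribInv A B D ⊠ₕ 𝟙 E) ≫ (mul.assoc (A ⊞ B) D E).hom =
      ((mul.assoc A D E).hom ⊞ₕ (mul.assoc B D E).hom) ≫ rdistribInv A B (D ⊠ E) := by
  have hm := isMul (C := C)
  have key : (mul.assoc (A ⊞ B) D E).hom = (rdistrib A B D ⊠ₕ 𝟙 E) ≫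
      rdistrib (A ⊠ D) (B ⊠ D) E ≫ ((mul.assoc A D E).hom ⊞ₕ (mul.assoc B D E).hom) ≫
        rdistribInv A B (D ⊠ E) := by
    rw [reassoc_of% rdistrib_mul_assoc, Completion.rdistrib_rdistribInv, Category.comp_id]
  rw [key, ← reassoc_of% hm.comp_hom_id, Completion.rdistribInv_rdistrib, hm.hom_id,
    Category.id_comp, reassoc_of% Completion.rdistribInv_rdistrib]

theorem distrib_inv_mul_assoc (A B D E : C) :
    (distrib (A ⊠ B) D E).inv ≫ (mul.assoc A B (D ⊞ E)).hom =
      ((mul.assoc A B D).hom ⊞ₕ (mul.assoc A B E).hom) ≫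
        (distrib A (B ⊠ D) (B ⊠ E)).inv ≫ (𝟙 A ⊠ₕ (distrib B D E).inv) := by
  have hm := isMul (C := C)
  rw [Iso.inv_comp_eq, ← reassoc_of% distrib_mul_assoc, Iso.hom_inv_id_assoc,
    ← hm.id_hom_comp, Iso.hom_inv_id, hm.hom_id, Category.comp_id]

theorem distrib_inv_rdistribInv_mul_assoc (A B D E : C) :
    rdistribInv (A ⊠ B) (A ⊠ D) E ≫ ((distrib A B D).inv ⊠ₕ 𝟙 E) ≫
        (mul.assoc A (B ⊞ D) E).hom =
      ((mul.assoc A B E).hom ⊞ₕ (mul.assoc A D E).hom) ≫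
        (distrib A (B ⊠ E) (D ⊠ E)).inv ≫ (𝟙 A ⊠ₕ rdistribInv B D E) := by
  have hm := isMul (C := C)
  have key : (mul.assoc A (B ⊞ D) E).hom = ((distrib A B D).hom ⊠ₕ 𝟙 E) ≫
      rdistrib (A ⊠ B) (A ⊠ D) E ≫ ((mul.assoc A B E).hom ⊞ₕ (mul.assoc A D E).hom) ≫
        (distrib A (B ⊠ E) (D ⊠ E)).inv ≫ (𝟙 A ⊠ₕ rdistribInv B D E) := by
    rw [← reassoc_of% distrib_rdistrib_mul_assoc, Iso.hom_inv_id_assoc,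
      ← hm.id_hom_comp, Completion.rdistrib_rdistribInv, hm.hom_id, Category.comp_id]
  rw [key, ← reassoc_of% hm.comp_hom_id, Iso.inv_hom_id, hm.hom_id,
    Category.id_comp, reassoc_of% Completion.rdistribInv_rdistrib]

theorem distrib_inv_mul_left (A B : C) :
    (distrib (unit C) A B).inv ≫ (mul.left (A ⊞ B)).hom =
      (mul.left A).hom ⊞ₕ (mul.left B).hom := by
  rw [← distrib_mul_left, Iso.inv_hom_id_assoc]

theorem rdistribInv_mul_right (A B : C) :
    rdistribInv A B (unit C) ≫ (mul.right (A ⊞ B)).hom =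
      (mul.right A).hom ⊞ₕ (mul.right B).hom := by
  rw [← rdistrib_mul_right, reassoc_of% Completion.rdistribInv_rdistrib]

theorem rdistribInv_symm (A B D : C) :
    rdistribInv A B D ≫ (mul.symm (A ⊞ B) D).hom =
      ((mul.symm A D).hom ⊞ₕ (mul.symm B D).hom) ≫ (distrib D A B).inv := by
  have hm := isMul (C := C)
  have e : ∀ A B : C, (mul.symm A B).inv = (mul.symm B A).hom := fun A B => by
    rw [← Category.comp_id (mul.symm A B).inv, Iso.inv_comp_eq, hm.symmetry]
  simp [rdistribInv, e, hm.symmetry]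

theorem distrib_inv_symm (A B D : C) :
    (distrib D A B).inv ≫ (mul.symm D (A ⊞ B)).hom =
      ((mul.symm D A).hom ⊞ₕ (mul.symm D B).hom) ≫ rdistribInv A B D := by
  have ha := isAdd (C := C)
  have hm := isMul (C := C)
  have e : ∀ A B : C, (mul.symm A B).inv = (mul.symm B A).hom := fun A B => by
    rw [← Category.comp_id (mul.symm A B).inv, Iso.inv_comp_eq, hm.symmetry]
  simp [rdistribInv, e, ← reassoc_of% ha.hom_comp, ha.hom_id, hm.symmetry]

theorem rdistribInv_distrib (A B D E : C) :
    rdistribInv A B (D ⊞ E) ≫ (distrib (A ⊞ B) D E).hom =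
      ((distrib A D E).hom ⊞ₕ (distrib B D E).hom) ≫
        add.mid (A ⊠ D) (A ⊠ E) (B ⊠ D) (B ⊠ E) ≫
          (rdistribInv A B D ⊞ₕ rdistribInv A B E) := by
  have ha := isAdd (C := C)
  have key : (distrib (A ⊞ B) D E).hom = rdistrib A B (D ⊞ E) ≫
      ((distrib A D E).hom ⊞ₕ (distrib B D E).hom) ≫
        add.mid (A ⊠ D) (A ⊠ E) (B ⊠ D) (B ⊠ E) ≫
          (rdistribInv A B D ⊞ₕ rdistribInv A B E) := by
    rw [← reassoc_of% distrib_rdistrib, ← ha.hom_comp, Completion.rdistrib_rdistribInv,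
      Completion.rdistrib_rdistribInv, ha.hom_id, Category.comp_id]
  rw [key, reassoc_of% Completion.rdistribInv_rdistrib]

end

/-! ### The completion is a rig category and the inclusion a rig functor. -/

namespace Completion

variable {C : Type u} [Category.{v} C] [RigData C] [IsRigCategory C]

/-- Naturality is treated one variable at a time, so that each of the three positions uses exactly
one of the three axioms linking distributors with the associator of `⊠`. -/
theorem mulHom_assoc_first {A A' : C} (f : (⟨A⟩ : Completion C) ⟶ ⟨A'⟩) (B D : C) :
    mulHom (mulHom f (𝟙 (⟨B⟩ : Completion C))) (𝟙 (⟨D⟩ : Completion C)) ≫ inc (mul.assoc A' B D).hom =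
      inc (mul.assoc A B D).hom ≫ mulHom f (𝟙 (⟨B ⊠ D⟩ : Completion C)) := by
  have ha := isAdd (C := C)
  have hm := isMul (C := C)
  induction f using hom_ind with | h H f => ?_
  simp only [mulHom_homMk_id, homMk_comp_inc, inc_comp_homMk]
  refine homMk_eq _ _ (mul.assoc H B D).hom ?_
  rw [hm.comp_hom_id, Category.assoc, Category.assoc, hm.assoc_natural, hm.hom_id,
    reassoc_of% rdistribInv_mul_assoc, ← reassoc_of% ha.hom_comp, Category.id_comp,
    Category.comp_id]

theorem mulHom_assoc_second {B B' : C} (A : C) (g : (⟨B⟩ : Completion C) ⟶ ⟨B'⟩) (D : C) :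
    mulHom (mulHom (𝟙 (⟨A⟩ : Completion C)) g) (𝟙 (⟨D⟩ : Completion C)) ≫ inc (mul.assoc A B' D).hom =
      inc (mul.assoc A B D).hom ≫ mulHom (𝟙 (⟨A⟩ : Completion C)) (mulHom g (𝟙 (⟨D⟩ : Completion C))) := by
  have ha := isAdd (C := C)
  have hm := isMul (C := C)
  induction g using hom_ind with | h H g => ?_
  simp only [mulHom_homMk_id, mulHom_id_homMk, homMk_comp_inc, inc_comp_homMk]
  refine homMk_eq _ _ (mul.assoc A H D).hom ?_
  rw [hm.comp_hom_id, Category.assoc, Category.assoc, hm.assoc_natural, hm.id_hom_comp,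
    reassoc_of% distrib_inv_rdistribInv_mul_assoc, ← reassoc_of% ha.hom_comp, Category.id_comp,
    Category.comp_id]

theorem mulHom_assoc_third {D D' : C} (A B : C) (h : (⟨D⟩ : Completion C) ⟶ ⟨D'⟩) :
    mulHom (𝟙 (⟨A ⊠ B⟩ : Completion C)) h ≫ inc (mul.assoc A B D').hom =
      inc (mul.assoc A B D).hom ≫ mulHom (𝟙 (⟨A⟩ : Completion C)) (mulHom (𝟙 (⟨B⟩ : Completion C)) h) := by
  have ha := isAdd (C := C)
  have hm := isMul (C := C)
  induction h using hom_ind with | h H h => ?_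
  simp only [mulHom_id_homMk, homMk_comp_inc, inc_comp_homMk]
  refine homMk_eq _ _ (mul.assoc A B H).hom ?_
  rw [Category.assoc, ← hm.hom_id, hm.assoc_natural, hm.id_hom_comp,
    reassoc_of% distrib_inv_mul_assoc, ← reassoc_of% ha.hom_comp, Category.id_comp,
    Category.comp_id]

theorem mulHom_assoc {A A' B B' D D' : C} (f : (⟨A⟩ : Completion C) ⟶ ⟨A'⟩)
    (g : (⟨B⟩ : Completion C) ⟶ ⟨B'⟩) (h : (⟨D⟩ : Completion C) ⟶ ⟨D'⟩) :
    mulHom (mulHom f g) h ≫ inc (mul.assoc A' B' D').hom =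
      inc (mul.assoc A B D).hom ≫ mulHom f (mulHom g h) := by
  rw [mulHom_eq_left_right (mulHom f g), mulHom_eq_left_right f, mulHom_comp_id, Category.assoc,
    Category.assoc, mulHom_assoc_third, reassoc_of% mulHom_assoc_second,
    reassoc_of% mulHom_assoc_first, ← mulHom_id_comp, ← mulHom_eq_left_right,
    ← mulHom_eq_left_right]

theorem mulHom_left {A A' : C} (f : (⟨A⟩ : Completion C) ⟶ ⟨A'⟩) :
    mulHom (𝟙 _) f ≫ inc (mul.left A').hom = inc (mul.left A).hom ≫ f := by
  have ha := isAdd (C := C)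
  have hm := isMul (C := C)
  induction f using hom_ind with | h H f => ?_
  simp only [mulHom_id_homMk, homMk_comp_inc, inc_comp_homMk]
  refine homMk_eq _ _ (mul.left H).hom ?_
  rw [Category.assoc, hm.left_natural, reassoc_of% distrib_inv_mul_left,
    ← reassoc_of% ha.hom_comp, Category.id_comp, Category.comp_id]

theorem mulHom_right {A A' : C} (f : (⟨A⟩ : Completion C) ⟶ ⟨A'⟩) :
    mulHom f (𝟙 _) ≫ inc (mul.right A').hom = inc (mul.right A).hom ≫ f := by
  have ha := isAdd (C := C)
  have hm := isMul (C := C)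
  induction f using hom_ind with | h H f => ?_
  simp only [mulHom_homMk_id, homMk_comp_inc, inc_comp_homMk]
  refine homMk_eq _ _ (mul.right H).hom ?_
  rw [Category.assoc, hm.right_natural, reassoc_of% rdistribInv_mul_right,
    ← reassoc_of% ha.hom_comp, Category.id_comp, Category.comp_id]

theorem mulHom_symm {A A' B B' : C} (f : (⟨A⟩ : Completion C) ⟶ ⟨A'⟩)
    (g : (⟨B⟩ : Completion C) ⟶ ⟨B'⟩) :
    mulHom f g ≫ inc (mul.symm A' B').hom = inc (mul.symm A B).hom ≫ mulHom g f := by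
  have ha := isAdd (C := C)
  have hm := isMul (C := C)
  have e₁ : mulHom f (𝟙 (⟨B⟩ : Completion C)) ≫ inc (mul.symm A' B).hom =
      inc (mul.symm A B).hom ≫ mulHom (𝟙 _) f := by
    induction f using hom_ind with | h H f => ?_
    simp only [mulHom_homMk_id, mulHom_id_homMk, homMk_comp_inc, inc_comp_homMk]
    refine homMk_eq _ _ (mul.symm H B).hom ?_
    rw [Category.assoc, hm.symm_natural, reassoc_of% rdistribInv_symm,
      ← reassoc_of% ha.hom_comp, Category.id_comp, Category.comp_id]
  have e₂ : mulHom (𝟙 (⟨A'⟩ : Completion C)) g ≫ inc (mul.symm A' B').hom =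
      inc (mul.symm A' B).hom ≫ mulHom g (𝟙 _) := by
    induction g using hom_ind with | h H g => ?_
    simp only [mulHom_homMk_id, mulHom_id_homMk, homMk_comp_inc, inc_comp_homMk]
    refine homMk_eq _ _ (mul.symm A' H).hom ?_
    rw [Category.assoc, hm.symm_natural, reassoc_of% distrib_inv_symm,
      ← reassoc_of% ha.hom_comp, Category.id_comp, Category.comp_id]
  rw [mulHom_eq_left_right, Category.assoc, e₂, reassoc_of% e₁, ← mulHom_eq_right_left]

/-- Separating the variables again: for `f` the point is that the two expansions of a product of
sums agree, for `g` and `h` that `A' ⊠ -` respects the interchange (`distrib_inv_mid`). -/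
theorem mulHom_distrib {A A' B B' D D' : C} (f : (⟨A⟩ : Completion C) ⟶ ⟨A'⟩)
    (g : (⟨B⟩ : Completion C) ⟶ ⟨B'⟩) (h : (⟨D⟩ : Completion C) ⟶ ⟨D'⟩) :
    mulHom f (addHom g h) ≫ inc (distrib A' B' D').hom =
      inc (distrib A B D).hom ≫ addHom (mulHom f g) (mulHom f h) := by
  have ha := isAdd (C := C)
  have hm := isMul (C := C)
  have e₁ : mulHom f (𝟙 (⟨B ⊞ D⟩ : Completion C)) ≫ inc (distrib A' B D).hom =
      inc (distrib A B D).hom ≫ addHom (mulHom f (𝟙 _)) (mulHom f (𝟙 _)) := by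
    induction f using hom_ind with | h H f => ?_
    simp only [mulHom_homMk_id, addHom_homMk, homMk_comp_inc, inc_comp_homMk]
    refine homMk_eq _ _ (distrib H B D).hom ?_
    rw [Category.assoc, ← ha.hom_id, distrib_natural, reassoc_of% rdistribInv_distrib,
      ← reassoc_of% ha.hom_comp, ← ha.hom_comp, Category.id_comp,
      Category.comp_id]
  have e₂ : mulHom (𝟙 (⟨A'⟩ : Completion C)) (addHom g h) ≫ inc (distrib A' B' D').hom =
      inc (distrib A' B D).hom ≫ addHom (mulHom (𝟙 _) g) (mulHom (𝟙 _) h) := by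
    induction g using hom_ind with | h H g => ?_
    induction h using hom_ind with | h K h => ?_
    simp only [mulHom_id_homMk, addHom_homMk, homMk_comp_inc, inc_comp_homMk]
    refine homMk_eq _ _ (distrib A' H K).hom ?_
    rw [Category.assoc, hm.id_hom_comp, Category.assoc, distrib_natural,
      reassoc_of% distrib_inv_mid, ← reassoc_of% ha.hom_comp, ← ha.hom_comp,
      Category.id_comp, Category.comp_id]
  rw [mulHom_eq_left_right, Category.assoc, e₂, reassoc_of% e₁, ← addHom_comp,
    ← mulHom_eq_left_right, ← mulHom_eq_left_right]

theorem mul_isSymMon : (mul : SymMonData (Completion C)).IsSymMon where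
  hom_id A B := mulHom_id A.of B.of
  hom_comp f f' g g' := mulHom_comp f f' g g'
  assoc_natural f g h := mulHom_assoc f g h
  left_natural f := mulHom_left f
  right_natural f := mulHom_right f
  symm_natural f g := mulHom_symm f g
  pentagon A B D E := by
    have := congr_arg inc ((isMul (C := C)).pentagon A.of B.of D.of E.of)
    simp only [inc_comp, ← mulHom_inc, inc_id] at this
    exact this
  triangle A B := by
    have := congr_arg inc ((isMul (C := C)).triangle A.of B.of)
    simp only [inc_comp, ← mulHom_inc, inc_id] at this
    exact this
  hexagon A B D := by
    have := congr_arg inc ((isMul (C := C)).hexagon A.of B.of D.of)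
    simp only [inc_comp, ← mulHom_inc, inc_id] at this
    exact this
  symmetry A B := by
    have := congr_arg inc ((isMul (C := C)).symmetry A.of B.of)
    simp only [inc_comp, inc_id] at this
    exact this

theorem rdistrib_eq (A B D : C) :
    rdistrib (⟨A⟩ : Completion C) ⟨B⟩ ⟨D⟩ = inc (rdistrib A B D) := by
  simp only [rdistrib, inc_comp, ← addHom_inc]
  rfl

/-- Initiality of `0` transported along `e`; rig axioms whose source is isomorphic to `0` then need
no computation. -/
theorem to_zero_hom_ext {X Y : C} (e : X ≅ zero C) (f g : (⟨X⟩ : Completion C) ⟶ ⟨Y⟩) : f = g := by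
  have := zero_hom_ext (inc e.inv ≫ f) (inc e.inv ≫ g)
  have e' := inc e.hom ≫= this
  simpa only [← Category.assoc, ← inc_comp, Iso.hom_inv_id, inc_id, Category.id_comp] using e'

instance isRigCategory : IsRigCategory (Completion C) where
  isAdd := add_isSymMon
  isMul := mul_isSymMon
  distrib_natural f g h := mulHom_distrib f g h
  annih_natural {A A'} f := to_zero_hom_ext (annih A.of) _ _
  distrib_symm A B D := by
    have := congr_arg inc (distrib_symm A.of B.of D.of)
    simp only [inc_comp, ← mulHom_inc, inc_id] at this
    exact this
  rdistrib_symm A B D := by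
    have := congr_arg inc (rdistrib_symm A.of B.of D.of)
    simp only [rdistrib, inc_comp, ← mulHom_inc, ← addHom_inc, inc_id] at this
    exact this
  distrib_add_assoc A B D E := by
    have := congr_arg inc (distrib_add_assoc A.of B.of D.of E.of)
    simp only [inc_comp, ← mulHom_inc, ← addHom_inc, inc_id] at this
    exact this
  rdistrib_add_assoc A B D E := by
    have := congr_arg inc (rdistrib_add_assoc A.of B.of D.of E.of)
    simp only [rdistrib, inc_comp, ← mulHom_inc, ← addHom_inc, inc_id] at this
    exact this
  distrib_mul_assoc A B D E := by
    have := congr_arg inc (distrib_mul_assoc A.of B.of D.of E.of)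
    simp only [inc_comp, ← mulHom_inc, ← addHom_inc, inc_id] at this
    exact this
  rdistrib_mul_assoc A B D E := by
    have := congr_arg inc (rdistrib_mul_assoc A.of B.of D.of E.of)
    simp only [inc_comp, ← mulHom_inc, ← addHom_inc, inc_id, ← rdistrib_eq] at this
    exact this
  distrib_rdistrib_mul_assoc A B D E := by
    have := congr_arg inc (distrib_rdistrib_mul_assoc A.of B.of D.of E.of)
    simp only [inc_comp, ← mulHom_inc, ← addHom_inc, inc_id, ← rdistrib_eq] at this
    exact this
  distrib_rdistrib A B D E := by
    have := congr_arg inc (distrib_rdistrib A.of B.of D.of E.of)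
    simp only [SymMonData.mid, inc_comp, ← addHom_inc, inc_id, ← rdistrib_eq] at this
    exact this
  lannih_zero := to_zero_hom_ext (annih _) _ _
  lannih_add A B := to_zero_hom_ext (mul.symm _ _ ≪≫ annih _) _ _
  annih_add A B := to_zero_hom_ext (annih _) _ _
  lannih_unit := to_zero_hom_ext (mul.right _) _ _
  annih_unit := to_zero_hom_ext (annih _) _ _
  lannih_mul A B := by
    have := congr_arg inc (lannih_mul A.of B.of)
    simp only [lannih, inc_comp, ← mulHom_inc, inc_id] at this
    exact this
  lannih_annih_mul A B := by
    have := congr_arg inc (lannih_annih_mul A.of B.of)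
    simp only [lannih, inc_comp, ← mulHom_inc, inc_id] at this
    exact this
  annih_mul A B := by
    have := congr_arg inc (annih_mul A.of B.of)
    simp only [inc_comp, ← mulHom_inc, inc_id] at this
    exact this
  distrib_add_left A B := by
    have := congr_arg inc (distrib_add_left A.of B.of)
    simp only [inc_comp, ← mulHom_inc, ← addHom_inc, inc_id] at this
    exact this
  rdistrib_add_left A B := by
    have := congr_arg inc (rdistrib_add_left A.of B.of)
    simp only [lannih, inc_comp, ← mulHom_inc, ← addHom_inc, inc_id, ← rdistrib_eq] at this
    exact this
  distrib_add_right A B := by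
    have := congr_arg inc (distrib_add_right A.of B.of)
    simp only [inc_comp, ← mulHom_inc, ← addHom_inc, inc_id] at this
    exact this
  rdistrib_add_right A B := by
    have := congr_arg inc (rdistrib_add_right A.of B.of)
    simp only [lannih, inc_comp, ← mulHom_inc, ← addHom_inc, inc_id, ← rdistrib_eq] at this
    exact this
  distrib_mul_left A B := by
    have := congr_arg inc (distrib_mul_left A.of B.of)
    simp only [inc_comp, ← addHom_inc] at this
    exact this
  rdistrib_mul_right A B := by
    have := congr_arg inc (rdistrib_mul_right A.of B.of)
    simp only [inc_comp, ← addHom_inc, ← rdistrib_eq] at this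
    exact this

theorem incl_isRigFunctor : (incl C).IsRigFunctor where
  isAdd :=
    { natural := fun f g =>
        (Category.comp_id _).trans ((addHom_inc f g).trans (Category.id_comp _).symm)
      assoc := fun A B D => by
        change addHom (𝟙 _) (𝟙 _) ≫ 𝟙 _ ≫ inc (add.assoc A B D).hom =
          inc (add.assoc A B D).hom ≫ addHom (𝟙 _) (𝟙 _) ≫ 𝟙 _
        simp [addHom_id]
      left := fun A => by
        change inc (add.left A).hom = addHom (𝟙 _) (𝟙 _) ≫ 𝟙 _ ≫ inc (add.left A).hom
        simp [addHom_id]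
      right := fun A => by
        change inc (add.right A).hom = addHom (𝟙 _) (𝟙 _) ≫ 𝟙 _ ≫ inc (add.right A).hom
        simp [addHom_id]
      symm := fun A B =>
        (Category.id_comp _).trans (Category.comp_id _).symm }
  isMul :=
    { natural := fun f g =>
        (Category.comp_id _).trans ((mulHom_inc f g).trans (Category.id_comp _).symm)
      assoc := fun A B D => by
        change mulHom (𝟙 _) (𝟙 _) ≫ 𝟙 _ ≫ inc (mul.assoc A B D).hom =
          inc (mul.assoc A B D).hom ≫ mulHom (𝟙 _) (𝟙 _) ≫ 𝟙 _
        simp [mulHom_id]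
      left := fun A => by
        change inc (mul.left A).hom = mulHom (𝟙 _) (𝟙 _) ≫ 𝟙 _ ≫ inc (mul.left A).hom
        simp [mulHom_id]
      right := fun A => by
        change inc (mul.right A).hom = mulHom (𝟙 _) (𝟙 _) ≫ 𝟙 _ ≫ inc (mul.right A).hom
        simp [mulHom_id]
      symm := fun A B =>
        (Category.id_comp _).trans (Category.comp_id _).symm }
  distrib A B D := by
    change mulHom (𝟙 _) (𝟙 _) ≫ 𝟙 _ ≫ inc (distrib A B D).hom =
      inc (distrib A B D).hom ≫ addHom (𝟙 _) (𝟙 _) ≫ 𝟙 _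
    simp [mulHom_id, addHom_id]
  annih A := by
    change mulHom (𝟙 _) (𝟙 _) ≫ 𝟙 _ ≫ inc (annih A).hom = inc (annih A).hom ≫ 𝟙 _
    simp [mulHom_id]

end Completion

/-! ### Injections into sums in a coaffine rig category. -/

namespace IsCoaffine

variable {E : Type u} [Category.{v} E] [RigData E] (hE : IsCoaffine E)

/-- The morphism out of the initial object. -/
noncomputable def initTo (A : E) : zero E ⟶ A := (hE A).some.default

include hE in
theorem hom_ext {A : E} (f g : zero E ⟶ A) : f = g :=
  (hE A).some.instSubsingleton.elim f g

include hE in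
theorem iso_hom_ext {X A : E} (e : X ≅ zero E) (f g : X ⟶ A) : f = g := by
  rw [← cancel_epi e.inv]
  exact hE.hom_ext _ _

/-- The first injection into a sum in a coaffine rig category. -/
noncomputable def inl (A H : E) : A ⟶ A ⊞ H := (add.right A).inv ≫ (𝟙 A ⊞ₕ hE.initTo H)

/-- By initiality any `k` will do, so it can be chosen to match the computation at hand. -/
theorem inl_eq {A H : E} (k : zero E ⟶ H) : hE.inl A H = (add.right A).inv ≫ (𝟙 A ⊞ₕ k) := by
  rw [inl, hE.hom_ext (hE.initTo H) k]

variable [IsRigCategory E]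

theorem inl_natural {A A' H H' : E} (f : A ⟶ A') (h : H ⟶ H') :
    hE.inl A H ≫ (f ⊞ₕ h) = f ≫ hE.inl A' H' := by
  have ha := isAdd (C := E)
  have e : (add.right A).inv ≫ (f ⊞ₕ 𝟙 (zero E)) = f ≫ (add.right A').inv := by
    rw [Iso.inv_comp_eq, ← reassoc_of% ha.right_natural, Iso.hom_inv_id, Category.comp_id]
  rw [inl, inl, ← reassoc_of% e, Category.assoc, ← ha.hom_comp, ← ha.hom_comp, Category.id_comp,
    Category.comp_id, hE.hom_ext (hE.initTo H ≫ h) (𝟙 _ ≫ hE.initTo H')]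

theorem inl_inl (A H K : E) :
    hE.inl A H ≫ hE.inl (A ⊞ H) K = hE.inl A (H ⊞ K) ≫ (add.assoc A H K).inv := by
  have ha := isAdd (C := E)
  have e : (add.right (A ⊞ H)).inv =
      (𝟙 A ⊞ₕ (add.right H).inv) ≫ (add.assoc A H (zero E)).inv := by
    let _ := ha.toMonoidalCategory
    exact rightUnitor_tensor_inv A H
  rw [inl, inl, e, Category.assoc, Category.assoc, ← ha.hom_id, ← ha.assoc_inv_natural,
    ← reassoc_of% ha.hom_comp, ← reassoc_of% ha.hom_comp, Category.id_comp, Category.id_comp,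
    ← reassoc_of% hE.inl_eq]

theorem inl_add_inl (A H A' H' : E) :
    (hE.inl A H ⊞ₕ hE.inl A' H') = hE.inl (A ⊞ A') (H ⊞ H') ≫ add.mid A A' H H' := by
  have ha := isAdd (C := E)
  have e : ((add.right A).inv ⊞ₕ (add.right A').inv) = (add.right (A ⊞ A')).inv ≫
      (𝟙 _ ⊞ₕ (add.left (zero E)).inv) ≫ add.mid A A' (zero E) (zero E) := by
    have := ha.mid_right A A'
    rw [Iso.eq_inv_comp, this]
    simp [← ha.hom_comp, ha.hom_id]
  rw [inl, inl, ha.hom_comp, e, Category.assoc, Category.assoc, ← ha.mid_natural,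
    ← reassoc_of% ha.hom_comp, ha.hom_id, Category.id_comp, ← reassoc_of% hE.inl_eq]

/-- The object `0 ⊠ D` is initial by annihilation, so whiskering the map `0 ⟶ H` by `D` gives the
map out of `0` again; the unit axiom for the right distributor does the rest. -/
theorem inl_mul_id (A H D : E) :
    (hE.inl A H ⊠ₕ 𝟙 D) = hE.inl (A ⊠ D) (H ⊠ D) ≫ rdistribInv A H D := by
  have ha := isAdd (C := E)
  have hm := isMul (C := E)
  have e : ((add.right A).inv ⊠ₕ 𝟙 D) ≫ rdistrib A (zero E) D ≫ (𝟙 _ ⊞ₕ lannih D) =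
      (add.right (A ⊠ D)).inv := by
    rw [← cancel_mono (add.right _).hom, Category.assoc, Category.assoc, Iso.inv_hom_id,
      rdistrib_add_right, ← hm.comp_hom_id,
      Iso.inv_hom_id, hm.hom_id]
  have e' : (hE.initTo H ⊠ₕ 𝟙 D) = lannih D ≫ hE.initTo (H ⊠ D) :=
    hE.iso_hom_ext (mul.symm _ _ ≪≫ annih D) _ _
  have key : (hE.inl A H ⊠ₕ 𝟙 D) ≫ rdistrib A H D = hE.inl (A ⊠ D) (H ⊠ D) := by
    rw [inl, inl, hm.comp_hom_id, Category.assoc, Completion.rdistrib_natural, e', hm.hom_id,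
      ha.id_hom_comp, reassoc_of% e]
  rw [← key, Category.assoc, Completion.rdistrib_rdistribInv, Category.comp_id]

theorem id_mul_inl (A B H : E) :
    (𝟙 A ⊠ₕ hE.inl B H) = hE.inl (A ⊠ B) (A ⊠ H) ≫ (distrib A B H).inv := by
  have ha := isAdd (C := E)
  have hm := isMul (C := E)
  have e : (𝟙 A ⊠ₕ (add.right B).inv) ≫ (distrib A B (zero E)).hom ≫ (𝟙 _ ⊞ₕ (annih A).hom) =
      (add.right (A ⊠ B)).inv := by
    rw [← cancel_mono (add.right _).hom, Category.assoc, Category.assoc, Iso.inv_hom_id,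
      distrib_add_right, ← hm.id_hom_comp,
      Iso.inv_hom_id, hm.hom_id]
  have e' : (𝟙 A ⊠ₕ hE.initTo H) = (annih A).hom ≫ hE.initTo (A ⊠ H) :=
    hE.iso_hom_ext (annih A) _ _
  rw [Iso.eq_comp_inv, inl, inl, hm.id_hom_comp, Category.assoc, distrib_natural, e', hm.hom_id,
    ha.id_hom_comp, reassoc_of% e]

end IsCoaffine

/-! ### Rig functors: extensionality and compatibility with derived structure. -/

/-- Both sides are built on the same `obj`, so the dependent fields can be compared without
transport. -/
theorem RigFunctorData.ext_of_map {C : Type u} [Category.{v} C] [RigData C] {E : Type u₁}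
    [Category.{v₁} E] [RigData E] {obj : C → E}
    {map map' : ∀ {X Y : C}, (X ⟶ Y) → (obj X ⟶ obj Y)} {h₁ h₁' h₂ h₂'}
    {a a' : TensorComparison (add : SymMonData C) (add : SymMonData E) obj}
    {m m' : TensorComparison (mul : SymMonData C) (mul : SymMonData E) obj}
    (h : ∀ {X Y : C} (f : X ⟶ Y), map f = map' f) (ha : a = a') (hm : m = m') :
    (⟨⟨obj, map, h₁, h₂⟩, a, m⟩ : RigFunctorData C E) = ⟨⟨obj, map', h₁', h₂'⟩, a', m'⟩ := by
  obtain rfl : @map = @map' := by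
    funext X Y f
    exact h f
  subst ha hm
  rfl

namespace RigFunctorData.IsRigFunctor

variable {C : Type u} [Category.{v} C] [RigData C]
variable {E : Type u₁} [Category.{v₁} E] [RigData E]
variable {F : RigFunctorData C E} (hF : F.IsRigFunctor)
include hF

theorem distrib_inv (A B D : C) :
    (RigData.distrib (F.obj A) (F.obj B) (F.obj D)).inv ≫
        (𝟙 (F.obj A) ⊠ₕ (F.addComp.μ B D).hom) ≫ (F.mulComp.μ A (B ⊞ D)).hom =
      ((F.mulComp.μ A B).hom ⊞ₕ (F.mulComp.μ A D).hom) ≫ (F.addComp.μ (A ⊠ B) (A ⊠ D)).hom ≫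
        F.map (RigData.distrib A B D).inv := by
  have e := (RigData.distrib (F.obj A) (F.obj B) (F.obj D)).inv ≫= hF.distrib A B D =≫
    F.map (RigData.distrib A B D).inv
  simpa only [Category.assoc, ← F.map_comp, Iso.hom_inv_id, F.map_id,
    Iso.inv_hom_id_assoc, Category.comp_id] using e

theorem add_assoc_inv (A B D : C) :
    (add.assoc (F.obj A) (F.obj B) (F.obj D)).inv ≫ ((F.addComp.μ A B).hom ⊞ₕ 𝟙 (F.obj D)) ≫
        (F.addComp.μ (A ⊞ B) D).hom =
      (𝟙 (F.obj A) ⊞ₕ (F.addComp.μ B D).hom) ≫ (F.addComp.μ A (B ⊞ D)).hom ≫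
        F.map (add.assoc A B D).inv := by
  have e := (add.assoc (F.obj A) (F.obj B) (F.obj D)).inv ≫= hF.isAdd.assoc A B D =≫
    F.map (add.assoc A B D).inv
  simpa only [Category.assoc, ← F.map_comp, Iso.hom_inv_id, F.map_id,
    Iso.inv_hom_id_assoc, Category.comp_id] using e

variable [IsRigCategory E]

theorem rdistrib (A B D : C) :
    ((F.addComp.μ A B).hom ⊠ₕ 𝟙 (F.obj D)) ≫ (F.mulComp.μ (A ⊞ B) D).hom ≫
        F.map (Rig.rdistrib A B D) =
      Rig.rdistrib (F.obj A) (F.obj B) (F.obj D) ≫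
        ((F.mulComp.μ A D).hom ⊞ₕ (F.mulComp.μ B D).hom) ≫ (F.addComp.μ (A ⊠ D) (B ⊠ D)).hom := by
  have ha := IsRigCategory.isAdd (C := E)
  have hm := IsRigCategory.isMul (C := E)
  simp only [Rig.rdistrib, F.map_comp, Category.assoc]
  rw [reassoc_of% hF.isMul.symm, reassoc_of% hm.symm_natural, reassoc_of% hF.distrib,
    ← hF.isAdd.natural, ← reassoc_of% ha.hom_comp, ← reassoc_of% ha.hom_comp, hF.isMul.symm,
    hF.isMul.symm]

variable [IsRigCategory C]

theorem rdistribInv (A B D : C) :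
    Rig.rdistribInv (F.obj A) (F.obj B) (F.obj D) ≫ ((F.addComp.μ A B).hom ⊠ₕ 𝟙 (F.obj D)) ≫
        (F.mulComp.μ (A ⊞ B) D).hom =
      ((F.mulComp.μ A D).hom ⊞ₕ (F.mulComp.μ B D).hom) ≫ (F.addComp.μ (A ⊠ D) (B ⊠ D)).hom ≫
        F.map (Rig.rdistribInv A B D) := by
  have e := Rig.rdistribInv (F.obj A) (F.obj B) (F.obj D) ≫= hF.rdistrib A B D =≫
    F.map (Rig.rdistribInv A B D)
  simpa only [Category.assoc, ← F.map_comp, Completion.rdistrib_rdistribInv, F.map_id,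
    reassoc_of% Completion.rdistribInv_rdistrib, Category.comp_id] using e

/-- The additive comparisons make `F` a braided lax monoidal functor, and such functors respect the
interchange. -/
theorem mid_comp_μ (A B D K : C) :
    add.mid (F.obj A) (F.obj B) (F.obj D) (F.obj K) ≫
        ((F.addComp.μ A D).hom ⊞ₕ (F.addComp.μ B K).hom) ≫
        (F.addComp.μ (A ⊞ D) (B ⊞ K)).hom =
      ((F.addComp.μ A B).hom ⊞ₕ (F.addComp.μ D K).hom) ≫
        (F.addComp.μ (A ⊞ B) (D ⊞ K)).hom ≫ F.map (add.mid A B D K) := by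
  let _ := (IsRigCategory.isAdd (C := C)).toMonoidalCategory
  let _ := (IsRigCategory.isAdd (C := C)).toSymmetricCategory
  let _ := (IsRigCategory.isAdd (C := E)).toMonoidalCategory
  let _ := (IsRigCategory.isAdd (C := E)).toSymmetricCategory
  let _ : F.toFunctor.LaxMonoidal := Functor.LaxMonoidal.ofTensorHom (F := F.toFunctor)
    F.addComp.ε.hom (fun X Y => (F.addComp.μ X Y).hom)
    (fun f g => hF.isAdd.natural f g)
    (fun X Y Z => hF.isAdd.assoc X Y Z)
    (fun X => hF.isAdd.left X)
    (fun X => hF.isAdd.right X)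
  let _ : F.toFunctor.LaxBraided := ⟨fun X Y => hF.isAdd.symm X Y⟩
  exact tensorμ_comp_μ_tensorHom_μ_comp_μ F.toFunctor A B D K
end RigFunctorData.IsRigFunctor

/-! ### The extension to the completion and its uniqueness. -/

namespace Completion

variable {C : Type u} [Category.{v} C] [RigData C] [IsRigCategory C]
variable {E : Type u₁} [Category.{v₁} E] [RigData E] [IsRigCategory E] (hE : IsCoaffine E)
variable {F : RigFunctorData C E} (hF : F.IsRigFunctor)

/-- The action on morphisms of the extension of `F` to the completion. -/
noncomputable def liftMap {A B : C} : ((⟨A⟩ : Completion C) ⟶ ⟨B⟩) → (F.obj A ⟶ F.obj B) :=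
  Quot.lift (fun f => hE.inl (F.obj A) (F.obj f.heap) ≫ (F.addComp.μ A f.heap).hom ≫ F.map f.map)
    (by
      rintro ⟨H, f⟩ ⟨H', f'⟩ ⟨h, e⟩
      dsimp only at h e
      subst e
      dsimp only
      -- Naturality of the injection in its heap absorbs `F.map h`, so mediated programs have the
      -- same image.
      rw [F.map_comp, ← reassoc_of% hF.isAdd.natural, reassoc_of% hE.inl_natural, F.map_id,
        Category.id_comp])

theorem liftMap_homMk {A B H : C} (f : A ⊞ H ⟶ B) :
    liftMap hE hF (homMk f) =
      hE.inl (F.obj A) (F.obj H) ≫ (F.addComp.μ A H).hom ≫ F.map f := rfl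

theorem liftMap_inc {A B : C} (f : A ⟶ B) : liftMap hE hF (inc f) = F.map f := by
  -- The map out of `0` is taken to be `ε`, so that the right unit law of `F` cancels it.
  rw [inc, liftMap_homMk, F.map_comp, hE.inl_eq F.addComp.ε.hom, Category.assoc,
    ← reassoc_of% hF.isAdd.right, Iso.inv_hom_id_assoc]

theorem liftMap_id (A : C) : liftMap hE hF (𝟙 (⟨A⟩ : Completion C)) = 𝟙 _ := by
  rw [← inc_id, liftMap_inc, F.map_id]

theorem liftMap_comp {A B D : C} (f : (⟨A⟩ : Completion C) ⟶ ⟨B⟩)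
    (g : (⟨B⟩ : Completion C) ⟶ ⟨D⟩) :
    liftMap hE hF (f ≫ g) = liftMap hE hF f ≫ liftMap hE hF g := by
  have ha := isAdd (C := E)
  induction f using hom_ind with | h H f => ?_
  induction g using hom_ind with | h K g => ?_
  rw [homMk_comp, liftMap_homMk, liftMap_homMk, liftMap_homMk, F.map_comp, F.map_comp]
  have e : ((F.addComp.μ A H).hom ≫ F.map f) ≫ hE.inl (F.obj B) (F.obj K) =
      hE.inl _ _ ≫ ((F.addComp.μ A H).hom ⊞ₕ 𝟙 _) ≫ (F.map f ⊞ₕ F.map (𝟙 K)) := by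
    rw [← hE.inl_natural _ (𝟙 (F.obj K)), F.map_id, ha.comp_hom_id]
  rw [Category.assoc, Category.assoc, reassoc_of% e, reassoc_of% hE.inl_inl, reassoc_of% hF.isAdd.natural,
    reassoc_of% hF.add_assoc_inv, reassoc_of% hE.inl_natural, Category.id_comp]

theorem liftMap_addHom {A A' B B' : C} (f : (⟨A⟩ : Completion C) ⟶ ⟨A'⟩)
    (g : (⟨B⟩ : Completion C) ⟶ ⟨B'⟩) :
    (liftMap hE hF f ⊞ₕ liftMap hE hF g) ≫ (F.addComp.μ A' B').hom =
      (F.addComp.μ A B).hom ≫ liftMap hE hF (addHom f g) := by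
  have ha := isAdd (C := E)
  induction f using hom_ind with | h H f => ?_
  induction g using hom_ind with | h K g => ?_
  rw [addHom_homMk, liftMap_homMk, liftMap_homMk, liftMap_homMk, F.map_comp, ha.hom_comp,
    ha.hom_comp, Category.assoc, Category.assoc, hF.isAdd.natural, hE.inl_add_inl,
    Category.assoc, reassoc_of% hF.mid_comp_μ, reassoc_of% hE.inl_natural]

theorem liftMap_mulHom_id {A A' : C} (f : (⟨A⟩ : Completion C) ⟶ ⟨A'⟩) (D : C) :
    (liftMap hE hF f ⊠ₕ 𝟙 _) ≫ (F.mulComp.μ A' D).hom =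
      (F.mulComp.μ A D).hom ≫ liftMap hE hF (mulHom f (𝟙 (⟨D⟩ : Completion C))) := by
  have hm := isMul (C := E)
  induction f using hom_ind with | h H f => ?_
  rw [mulHom_homMk_id, liftMap_homMk, liftMap_homMk, F.map_comp, hm.comp_hom_id,
    hm.comp_hom_id, Category.assoc, Category.assoc, ← F.map_id, hF.isMul.natural, F.map_id,
    hE.inl_mul_id, Category.assoc, reassoc_of% hF.rdistribInv, reassoc_of% hE.inl_natural]

theorem liftMap_id_mulHom {B B' : C} (A : C) (g : (⟨B⟩ : Completion C) ⟶ ⟨B'⟩) :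
    (𝟙 _ ⊠ₕ liftMap hE hF g) ≫ (F.mulComp.μ A B').hom =
      (F.mulComp.μ A B).hom ≫ liftMap hE hF (mulHom (𝟙 (⟨A⟩ : Completion C)) g) := by
  have hm := isMul (C := E)
  induction g using hom_ind with | h H g => ?_
  rw [mulHom_id_homMk, liftMap_homMk, liftMap_homMk, F.map_comp, hm.id_hom_comp,
    hm.id_hom_comp, Category.assoc, Category.assoc, ← F.map_id, hF.isMul.natural, F.map_id,
    hE.id_mul_inl, Category.assoc, reassoc_of% hF.distrib_inv, reassoc_of% hE.inl_natural]

theorem liftMap_mulHom {A A' B B' : C} (f : (⟨A⟩ : Completion C) ⟶ ⟨A'⟩)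
    (g : (⟨B⟩ : Completion C) ⟶ ⟨B'⟩) :
    (liftMap hE hF f ⊠ₕ liftMap hE hF g) ≫ (F.mulComp.μ A' B').hom =
      (F.mulComp.μ A B).hom ≫ liftMap hE hF (mulHom f g) := by
  rw [isMul.hom_left_right, mulHom_eq_left_right, liftMap_comp, Category.assoc,
    liftMap_id_mulHom, reassoc_of% liftMap_mulHom_id]

/-- The extension of a rig functor `F` into a coaffine rig category to the completion. -/
noncomputable def lift : RigFunctorData (Completion C) E where
  obj X := F.obj X.of
  map f := liftMap hE hF f
  map_id X := liftMap_id hE hF X.of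
  map_comp f g := liftMap_comp hE hF f g
  addComp :=
    { μ := fun X Y => F.addComp.μ X.of Y.of
      ε := F.addComp.ε }
  mulComp :=
    { μ := fun X Y => F.mulComp.μ X.of Y.of
      ε := F.mulComp.ε }

theorem lift_isRigFunctor : (lift hE hF).IsRigFunctor where
  isAdd :=
    { natural := fun f g => liftMap_addHom hE hF f g
      assoc := fun X Y Z => by
        have := hF.isAdd.assoc X.of Y.of Z.of
        -- Coherence maps of the completion come from `C`, where the extension agrees with `F`.
        rw [← liftMap_inc hE hF] at this
        exact this
      left := fun X => by
        have := hF.isAdd.left X.of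
        rw [← liftMap_inc hE hF] at this
        exact this
      right := fun X => by
        have := hF.isAdd.right X.of
        rw [← liftMap_inc hE hF] at this
        exact this
      symm := fun X Y => by
        have := hF.isAdd.symm X.of Y.of
        rw [← liftMap_inc hE hF] at this
        exact this }
  isMul :=
    { natural := fun f g => liftMap_mulHom hE hF f g
      assoc := fun X Y Z => by
        have := hF.isMul.assoc X.of Y.of Z.of
        rw [← liftMap_inc hE hF] at this
        exact this
      left := fun X => by
        have := hF.isMul.left X.of
        rw [← liftMap_inc hE hF] at this
        exact this
      right := fun X => by
        have := hF.isMul.right X.of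
        rw [← liftMap_inc hE hF] at this
        exact this
      symm := fun X Y => by
        have := hF.isMul.symm X.of Y.of
        rw [← liftMap_inc hE hF] at this
        exact this }
  distrib X Y Z := by
    have := hF.distrib X.of Y.of Z.of
    rw [← liftMap_inc hE hF] at this
    exact this
  annih X := by
    have := hF.annih X.of
    rw [← liftMap_inc hE hF] at this
    exact this

theorem incl_comp_lift : (incl C).comp (lift hE hF) = F := by
  refine RigFunctorData.ext_of_map (fun f => liftMap_inc hE hF f) ?_ ?_
  -- The inclusion is strict, so the comparisons of the composite are those of `F` followed by the
  -- image of an identity.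
  · ext
    · exact (congrArg _ (liftMap_id hE hF _)).trans (Category.comp_id _)
    · exact (congrArg _ (liftMap_id hE hF _)).trans (Category.comp_id _)
  · ext
    · exact (congrArg _ (liftMap_id hE hF _)).trans (Category.comp_id _)
    · exact (congrArg _ (liftMap_id hE hF _)).trans (Category.comp_id _)

/-- The injection is built from structural maps and a map out of `0`, so a rig functor into a
coaffine category has no choice in its value. -/
theorem inl_eq (A H : C) :
    inl A H = inc (add.right A).inv ≫ addHom (𝟙 _) (homMk (add.left H).hom) := by
  have ha := isAdd (C := C)
  have e : ((add.right A).inv ⊞ₕ 𝟙 (zero C ⊞ H)) ≫ add.mid A (zero C) (zero C) H ≫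
      ((add.right A).hom ⊞ₕ (add.left H).hom) = 𝟙 A ⊞ₕ (add.left H).hom := by
    let _ := ha.toMonoidalCategory
    let _ := ha.toSymmetricCategory
    exact rightUnitor_inv_tensorμ_leftUnitor A H
  rw [id_eq_homMk, addHom_homMk, inc_comp_homMk, inl, e]
  exact (homMk_eq _ _ (add.left H).hom (Category.comp_id _).symm).symm

theorem map_inl {G : RigFunctorData (Completion C) E} (hG : G.IsRigFunctor) (A H : C) :
    G.map (inl A H) = hE.inl (G.obj ⟨A⟩) (G.obj ⟨H⟩) ≫ (G.addComp.μ ⟨A⟩ ⟨H⟩).hom := by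
  have ha := isAdd (C := E)
  let z : (⟨zero C⟩ : Completion C) ⟶ ⟨H⟩ := homMk (add.left H).hom
  have e₁ : (G.map (𝟙 (⟨A⟩ : Completion C)) ⊞ₕ G.map z) ≫ (G.addComp.μ ⟨A⟩ ⟨H⟩).hom =
      (G.addComp.μ ⟨A⟩ ⟨zero C⟩).hom ≫ G.map (addHom (𝟙 _) z) := hG.isAdd.natural _ _
  have e₂ : (add.right (G.obj ⟨A⟩)).hom = (𝟙 _ ⊞ₕ G.addComp.ε.hom) ≫
      (G.addComp.μ ⟨A⟩ ⟨zero C⟩).hom ≫ G.map (inc (add.right A).hom) := hG.isAdd.right ⟨A⟩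
  have e₃ : G.map (inc (add.right A).hom) ≫ G.map (inc (add.right A).inv) = 𝟙 _ := by
    rw [← G.map_comp, ← inc_comp, Iso.hom_inv_id, inc_id, G.map_id]
  have e₄ : (add.right (G.obj ⟨A⟩)).hom ≫ G.map (inc (add.right A).inv) =
      (𝟙 _ ⊞ₕ G.addComp.ε.hom) ≫ (G.addComp.μ ⟨A⟩ ⟨zero C⟩).hom := by
    rw [e₂, Category.assoc, Category.assoc, e₃]
    exact congrArg _ (Category.comp_id _)
  rw [G.map_id] at e₁
  -- By initiality the map `0 ⟶ G H` may be taken to be `ε` followed by the image of `z : 0 ⟶ H`.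
  rw [inl_eq, G.map_comp, hE.inl_eq (G.addComp.ε.hom ≫ G.map z), Category.assoc,
    Iso.eq_inv_comp, reassoc_of% e₄, ← e₁, ha.id_hom_comp, Category.assoc]

theorem lift_incl_comp {G : RigFunctorData (Completion C) E} (hG : G.IsRigFunctor)
    (h : ((incl C).comp G).IsRigFunctor) : lift hE h = G := by
  refine RigFunctorData.ext_of_map (fun {X Y} f => ?_) ?_ ?_
  · induction f using hom_ind with | h H f => ?_
    have e : ((incl C).comp G).addComp.μ X.of H = G.addComp.μ ⟨X.of⟩ ⟨H⟩ := by
      ext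
      exact (congrArg _ (G.map_id _)).trans (Category.comp_id _)
    refine (liftMap_homMk hE h f).trans ?_
    -- `G` is determined on `inl` by `map_inl`, and on `inc f` by its composite with the inclusion.
    rw [e, homMk_eq_inl_comp, G.map_comp, map_inl hE hG, Category.assoc]
    rfl
  · ext
    · exact (congrArg _ (G.map_id _)).trans (Category.comp_id _)
    · exact (congrArg _ (G.map_id _)).trans (Category.comp_id _)
  · ext
    · exact (congrArg _ (G.map_id _)).trans (Category.comp_id _)
    · exact (congrArg _ (G.map_id _)).trans (Category.comp_id _)

end Completion

end Rig

theorem theorem5 {C : Type u} [Category.{v} C] [Rig.RigData C] [Rig.IsRigCategory C] :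
    Rig.IsRigCategory (Rig.Completion C) ∧
    Rig.IsCoaffine (Rig.Completion C) ∧
    (Rig.Completion.incl C).IsRigFunctor ∧
    ∀ (E : Type u₁) [Category.{v₁} E] [Rig.RigData E] [Rig.IsRigCategory E],
      Rig.IsCoaffine E →
      ∀ F : Rig.RigFunctorData C E, F.IsRigFunctor →
        ∃! G : Rig.RigFunctorData (Rig.Completion C) E,
          G.IsRigFunctor ∧ (Rig.Completion.incl C).comp G = F := by
  refine ⟨Rig.Completion.isRigCategory, Rig.Completion.isCoaffine,
    Rig.Completion.incl_isRigFunctor, fun E _ _ _ hE F hF => ⟨Rig.Completion.lift hE hF,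
      ⟨Rig.Completion.lift_isRigFunctor hE hF, Rig.Completion.incl_comp_lift hE hF⟩, ?_⟩⟩
  rintro G ⟨hG, rfl⟩
  exact (Rig.Completion.lift_incl_comp hE hG hF).symm
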